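/- Let $n\ge 2$ and let $f:(0,\infty)\to\mathbb R$ be continuous and strictly increasing; put $f(0)=\lim_{t\to 0^+}f(t)\in[-\infty,\infty)$. Let $\mathcal G_n$ be the set of all closed curves $G_n$ of length $n$ in $\mathbb R^3$ (self-intersections and overlaps allowed), each carrying $n$ particles $A_1,\dots,A_n$, in this cyclic order, evenly spaced with respect to arc length; that is, $G_n$ has an arc-length parametrization $\gamma:[0,n]\to\mathbb R^3$ with $\gamma(0)=\gamma(n)$ and $A_i=\gamma(i-1)$. Define $$E^f_n(G_n)=\sum_{1\le p<q\le n} f(|A_pA_q|).$$ If $G_n$ is a maximum point of $E^f_n$ on $\mathcal G_n$, then $G_n$ is a (possibly degenerate) convex planar $n$-gon with vertices $A_1,\dots,A_n$, in this cyclic order, and with each edge of length $1$. That is, with $A_{n+1}=A_1$: (a) for each $i$, $|A_iA_{i+1}|=1$, and the part of $G_n$ from $A_i$ to $A_{i+1}$ is the straight segment $A_iA_{i+1}$; (b) either $A_1,\dots,A_n$ are distinct points that lie in a plane but not on a line, the open segments $A_iA_{i+1}$ are pairwise disjoint, and the union of the segments $A_iA_{i+1}$ is the boundary, in that plane, of the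 convex hull of $\{A_1,\dots,A_n\}$ (angles equal to $\pi$ are allowed); or (degenerate case) $A_1,\dots,A_n$ lie on a line and the closed polygon $A_1A_2\cdots A_nA_1$ runs monotonically from one end of a segment to the other and then monotonically back. -/

import Mathlib

open Set

/-- Euclidean three-space. -/
abbrev Space3 : Type := EuclideanSpace ℝ (Fin 3)

/-- A flexible, non-extensible closed curve of length `n` in three-space (self-intersections and
overlaps are allowed), given on `[0, n]` by its arc-length parametrization: for
`0 ≤ a ≤ b ≤ n` the length of the part of the curve over `[a, b]` is `b - a`.
The values of `toFun` outside `[0, n]` carry no information. -/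
structure InextensibleClosedCurve (n : ℕ) where
  toFun : ℝ → Space3
  closed : toFun 0 = toFun n
  unitSpeed : HasUnitSpeedOn toFun (Icc (0 : ℝ) n)

/-- The `n` particles, evenly spaced along the curve with respect to arc length. They are
labelled `0, …, n - 1`, in the order in which they occur on the curve. -/
def InextensibleClosedCurve.particle {n : ℕ} (G : InextensibleClosedCurve n) (j : Fin n) :
    Space3 :=
  G.toFun ((j : ℕ) : ℝ)

/-- A function `f` on `(0, ∞)`, extended to distance `0` by `inf f`, which for an increasing `f`
is its limit at `0` from the right: a real number or `-∞`. -/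
noncomputable def extendToZero (f : ℝ → ℝ) (t : ℝ) : EReal :=
  if 0 < t then (f t : EReal) else ⨅ s : Ioi (0 : ℝ), (f s : EReal)

/-- The energy: the sum of `f` of the distance over all pairs `p < q` of particles. Its value
is a real number or `-∞`. -/
noncomputable def InextensibleClosedCurve.energy {n : ℕ} (f : ℝ → ℝ)
    (G : InextensibleClosedCurve n) : EReal :=
  ∑ p : Fin n, ∑ q ∈ Finset.Ioi p, extendToZero f (dist (G.particle p) (G.particle q))

/-- The closed polygon with vertices `A 0, …, A (n - 1)`, joined in this cyclic order, is a
(non-degenerate) convex `n`-gon: it lies in a plane but not on a line, its vertices are distinct,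
its edges do not overlap or cross, and together they are the boundary, relative to the plane, of
the convex hull of the vertices. Angles equal to `π` are allowed. -/
structure IsNondegenerateConvexPolygon {n : ℕ} [NeZero n] (A : Fin n → Space3) : Prop where
  coplanar : Coplanar ℝ (range A)
  not_collinear : ¬ Collinear ℝ (range A)
  injective : Function.Injective A
  edges_disjoint : ∀ i j : Fin n, i ≠ j →
    Disjoint (openSegment ℝ (A i) (A (i + 1))) (openSegment ℝ (A j) (A (j + 1)))
  edges_eq_boundary :
    ⋃ i : Fin n, segment ℝ (A i) (A (i + 1)) = intrinsicFrontier ℝ (convexHull ℝ (range A))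

/-- The closed polygon with vertices `A 0, …, A (n - 1)`, joined in this cyclic order, is a
degenerate convex `n`-gon, that is, a segment traversed once forth and once back: the vertices lie
on a line and, starting from some vertex `A s`, their position `x` on the line first runs
monotonically from one end to the other (steps `0, …, m`) and then monotonically back to `A s`
(steps `m, …, n`). -/
def IsDegenerateConvexPolygon {n : ℕ} [NeZero n] (A : Fin n → Space3) : Prop :=
  ∃ (s : Fin n) (m : ℕ) (v : Space3) (x : ℕ → ℝ),
    m ≤ n ∧ ‖v‖ = 1 ∧
    (∀ j ≤ n, A (s + Fin.ofNat n j) = A s + x j • v) ∧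
    MonotoneOn x (Icc 0 m) ∧ AntitoneOn x (Icc m n)

/-- A possibly degenerate convex `n`-gon. -/
def IsConvexPolygon {n : ℕ} [NeZero n] (A : Fin n → Space3) : Prop :=
  IsNondegenerateConvexPolygon A ∨ IsDegenerateConvexPolygon A

/-! As `f` increases strictly, no polygon with edges at most `1` can have all distances at least
those of a maximiser and one of them larger: such a polygon carries a competing curve
(`exists_curve_through`), because the spare length of an arc can be spent on a bend. This property,
`Taut`, is all that the geometry uses; each conclusion comes from a motion that would violate it.

Reflection. If two particles lie on a supporting plane, reflecting one of the two arcs between them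
in that plane preserves distances inside each arc and enlarges the distance of two points of
different arcs that are both off the plane. Hence one arc lies in the plane, and the indices on any
supporting plane are contiguous (`Taut.isCyclicInterval_contact`).

Tilting. At an exposed point, every face of the vertex figure must therefore contain the projection
of one of the two neighbouring particles. A vertex figure not on a line has three pairwise disjoint
faces, which is one too many; so the polygon is planar (`Taut.exists_normal`).

Hinge. If an edge is shorter than `1`, a small turn of part of the remaining chain about a
supporting line, out of the plane, enlarges distances while the slack of that edge absorbs its
growth. So all edges have length `1` (`Taut.dist_eq_one`).

Unfolding. If an arc lying on a supporting line and joining its extreme points runs back somewhere,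
the backward piece is unfolded and the arc is bent into two sides of a triangle. Lifting the polygon
slightly towards that shape violates tautness, so the arc is monotone (`Taut.eq_of_lift`,
`Taut.le_of_chain`).

In the noncollinear case every edge then lies on a proper supporting line, and every such line that
meets the polygon meets it in one strictly monotone arc, so the edges trace the boundary of the
hull. In the collinear case the two arcs between the extreme points are both monotone. -/

/-! ### Curves through prescribed particles -/

theorem hasUnitSpeedOn_Icc_of_dist_eq {E : Type*} [PseudoMetricSpace E] {f : ℝ → E} {a b : ℝ}
    (h : ∀ s ∈ Icc a b, ∀ t ∈ Icc a b, dist (f s) (f t) = |s - t|) :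
    HasUnitSpeedOn f (Icc a b) := by
  refine hasConstantSpeedOnWith_iff_ordered.2 fun x hx y hy hxy => le_antisymm ?_ ?_
  · have hlip : LipschitzOnWith 1 f (Icc a b) :=
      LipschitzOnWith.of_dist_le_mul fun s hs t ht => by
        simp [h s hs t ht, Real.dist_eq]
    have h1 := hlip.comp_eVariationOn_le (g := (id : ℝ → ℝ)) (s := Icc a b ∩ Icc x y)
      fun z hz => hz.1
    have h2 : eVariationOn (id : ℝ → ℝ) (Icc a b ∩ Icc x y) = ENNReal.ofReal (id y - id x) :=
      MonotoneOn.eVariationOn_eq (monotone_id.monotoneOn _) hx hy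
    simpa using h1.trans (by simpa using h2.le)
  · have h1 := eVariationOn.edist_le f (s := Icc a b ∩ Icc x y)
      (⟨hy, hxy, le_rfl⟩ : y ∈ Icc a b ∩ Icc x y) (⟨hx, le_rfl, hxy⟩ : x ∈ Icc a b ∩ Icc x y)
    rw [edist_dist, h y hy x hx, abs_of_nonneg (sub_nonneg.2 hxy)] at h1
    simpa using h1

/-- The path through the points `V 0, V 1, …`, the `k`-th one being reached at time `k / 2`. -/
noncomputable def halfStepPath (V : ℕ → Space3) (t : ℝ) : Space3 :=
  AffineMap.lineMap (V ⌊2 * t⌋₊) (V (⌊2 * t⌋₊ + 1)) (2 * t - ⌊2 * t⌋₊)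

theorem halfStepPath_eq (V : ℕ → Space3) (k : ℕ) {t : ℝ}
    (ht : t ∈ Icc ((k : ℝ) / 2) (((k + 1 : ℕ) : ℝ) / 2)) :
    halfStepPath V t = AffineMap.lineMap (V k) (V (k + 1)) (2 * t - k) := by
  obtain ⟨h1, h2⟩ := ht
  push_cast at h2
  rcases h2.eq_or_lt with h | h
  · have : 2 * t = ((k + 1 : ℕ) : ℝ) := by push_cast; linarith
    have h3 : ((k + 1 : ℕ) : ℝ) - k = 1 := by push_cast; ring
    rw [halfStepPath, this, Nat.floor_natCast, h3]
    simp
  · have : ⌊2 * t⌋₊ = k := by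
      rw [Nat.floor_eq_iff (by have : (0:ℝ) ≤ k := k.cast_nonneg
                               linarith)]
      constructor <;> linarith
    rw [halfStepPath, this]

theorem halfStepPath_apply (V : ℕ → Space3) (k : ℕ) : halfStepPath V ((k : ℝ) / 2) = V k := by
  rw [halfStepPath_eq V k ⟨le_rfl, by push_cast; linarith⟩]
  have : 2 * ((k : ℝ) / 2) - k = 0 := by ring
  simp [this]

theorem hasUnitSpeedOn_halfStepPath {V : ℕ → Space3} (hV : ∀ k, dist (V k) (V (k + 1)) = 1 / 2)
    (m : ℕ) : HasUnitSpeedOn (halfStepPath V) (Icc 0 ((m : ℝ) / 2)) := by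
  induction m with
  | zero =>
    exact hasConstantSpeedOnWith_of_subsingleton _ (by simp) _
  | succ m ih =>
    refine ih.Icc_Icc (hasUnitSpeedOn_Icc_of_dist_eq fun s hs t ht => ?_)
    rw [halfStepPath_eq V m hs, halfStepPath_eq V m ht, dist_lineMap_lineMap, hV, Real.dist_eq]
    have : 2 * s - m - (2 * t - m) = 2 * (s - t) := by ring
    rw [this, abs_mul, abs_two]
    ring

theorem exists_unit_orthogonal (p q : Space3) :
    ∃ z : Space3, ‖z‖ = 1 ∧ inner ℝ p z = 0 ∧ inner ℝ q z = 0 := by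
  set W := Submodule.span ℝ ({p, q} : Set Space3) with hW
  have h1 : Module.finrank ℝ W ≤ 2 := by
    have := finrank_span_finset_le_card (R := ℝ) ({p, q} : Finset Space3)
    rw [Finset.coe_pair] at this
    exact this.trans Finset.card_le_two
  have h2 := W.finrank_add_finrank_orthogonal
  have h3 : Module.finrank ℝ Space3 = 3 := by simp
  have h4 : 0 < Module.finrank ℝ Wᗮ := by omega
  obtain ⟨⟨y, hy⟩, hy0⟩ := Module.finrank_pos_iff_exists_ne_zero.1 h4
  have hy0' : y ≠ 0 := fun h => hy0 (Subtype.ext h)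
  have hpy := (Submodule.mem_orthogonal W y).1 hy p (Submodule.subset_span (by simp))
  have hqy := (Submodule.mem_orthogonal W y).1 hy q (Submodule.subset_span (by simp))
  refine ⟨(‖y‖)⁻¹ • y, ?_, ?_, ?_⟩
  · rw [norm_smul, norm_inv, norm_norm, inv_mul_cancel₀ (norm_ne_zero_iff.2 hy0')]
  · rw [inner_smul_right, hpy, mul_zero]
  · rw [inner_smul_right, hqy, mul_zero]

/-- `M` is the apex of an isosceles triangle on `P Q` with legs `1 / 2`; `r` is its height. -/
theorem exists_dist_eq_half {P Q : Space3} (h : dist P Q ≤ 1) :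
    ∃ M : Space3, dist P M = 1 / 2 ∧ dist M Q = 1 / 2 := by
  obtain ⟨z, hz, hz', -⟩ := exists_unit_orthogonal (Q - P) (Q - P)
  set r := Real.sqrt (1 / 4 - (dist P Q / 2) ^ 2)
  have hr : r ^ 2 = 1 / 4 - (dist P Q / 2) ^ 2 :=
    Real.sq_sqrt (by have := dist_nonneg (x := P) (y := Q); nlinarith)
  have hn : dist P Q = ‖Q - P‖ := by rw [dist_comm, dist_eq_norm]
  have key : ∀ s : ℝ, s ^ 2 = 1 → ‖(s / 2) • (Q - P) + r • z‖ = 1 / 2 := by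
    intro s hs
    have : ‖(s / 2) • (Q - P) + r • z‖ ^ 2 = (1 / 2) ^ 2 := by
      rw [norm_add_sq_real, inner_smul_left, inner_smul_right, hz', norm_smul, norm_smul, hz,
        mul_pow, mul_pow, ← hn, Real.norm_eq_abs, Real.norm_eq_abs, sq_abs, sq_abs, hr]
      simp only [mul_zero, conj_trivial]
      linear_combination (dist P Q) ^ 2 / 4 * hs
    exact (pow_left_inj₀ (norm_nonneg _) (by norm_num) two_ne_zero).1 this
  refine ⟨P + ((1 / 2 : ℝ) • (Q - P) + r • z), ?_, ?_⟩
  · rw [dist_eq_norm, sub_add_cancel_left, norm_neg]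
    exact key 1 (by norm_num)
  · rw [dist_eq_norm]
    refine Eq.trans ?_ (key (-1) (by norm_num))
    congr 1
    module

/-- Each unit arc consists of two segments of length `1 / 2` through an apex `M i`, so edges shorter
than `1` do no harm. Even indices of `V` are particles, odd ones are apexes. -/
theorem exists_curve_through {n : ℕ} [NeZero n] {B : Fin n → Space3}
    (hB : ∀ i, dist (B i) (B (i + 1)) ≤ 1) : ∃ G : InextensibleClosedCurve n, G.particle = B := by
  choose M hM1 hM2 using fun i => exists_dist_eq_half (hB i)
  set V : ℕ → Space3 := fun k =>
    if k % 2 = 0 then B (Fin.ofNat n (k / 2)) else M (Fin.ofNat n (k / 2)) with hV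
  have hsucc : ∀ j : ℕ, Fin.ofNat n (j + 1) = Fin.ofNat n j + 1 := fun j => by
    ext; simp [Fin.ofNat, Fin.val_add]
  have hV2 : ∀ k, dist (V k) (V (k + 1)) = 1 / 2 := by
    intro k
    rcases Nat.even_or_odd' k with ⟨j, rfl | rfl⟩
    · have h1 : (2 * j + 1) % 2 ≠ 0 := by omega
      have h2 : (2 * j) % 2 = 0 := by omega
      have h3 : (2 * j + 1) / 2 = j := by omega
      have h4 : 2 * j / 2 = j := by omega
      simp only [hV, h2, h1, h3, h4, if_true, if_false]
      exact hM1 _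
    · have h1 : (2 * j + 1) % 2 ≠ 0 := by omega
      have h2 : (2 * j + 1 + 1) % 2 = 0 := by omega
      have h3 : (2 * j + 1) / 2 = j := by omega
      have h4 : (2 * j + 1 + 1) / 2 = j + 1 := by omega
      simp only [hV, h2, h1, h3, h4, if_true, if_false, hsucc]
      exact hM2 _
  have hVe : ∀ j : ℕ, halfStepPath V (j : ℝ) = B (Fin.ofNat n j) := by
    intro j
    have h2 : (2 * j) % 2 = 0 := by omega
    have h4 : 2 * j / 2 = j := by omega
    have := halfStepPath_apply V (2 * j)
    have h5 : (((2 * j : ℕ) : ℝ)) / 2 = j := by push_cast; ring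
    rw [h5] at this
    rw [this]
    simp only [hV, h2, h4, if_true]
  refine ⟨⟨halfStepPath V, ?_, ?_⟩, ?_⟩
  · have h0 := hVe 0
    have hn := hVe n
    have : Fin.ofNat n 0 = Fin.ofNat n n := by ext; simp [Fin.ofNat]
    rw [hn, ← this, ← h0, Nat.cast_zero]
  · have := hasUnitSpeedOn_halfStepPath hV2 (2 * n)
    have h5 : (((2 * n : ℕ) : ℝ)) / 2 = n := by push_cast; ring
    rwa [h5] at this
  · funext i
    simp only [InextensibleClosedCurve.particle]
    rw [hVe]
    congr 1
    ext; simp [Fin.ofNat, Nat.mod_eq_of_lt i.2]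

theorem HasUnitSpeedOn.dist_le {f : ℝ → Space3} {s : Set ℝ} (h : HasUnitSpeedOn f s) {a b : ℝ}
    (ha : a ∈ s) (hb : b ∈ s) (hab : a ≤ b) : dist (f a) (f b) ≤ b - a := by
  have h1 := eVariationOn.edist_le f (s := s ∩ Icc a b) ⟨ha, le_rfl, hab⟩ ⟨hb, hab, le_rfl⟩
  rw [h ha hb, edist_dist, ENNReal.ofReal_le_ofReal_iff (by simpa using hab)] at h1
  simpa using h1

/-! ### The energy -/

theorem extendToZero_strictMonoOn {f : ℝ → ℝ} (hf : StrictMonoOn f (Ioi 0)) :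
    StrictMonoOn (extendToZero f) (Ici 0) := by
  intro a ha b hb hab
  have hb0 : 0 < b := lt_of_le_of_lt ha hab
  rcases (show (0 : ℝ) ≤ a from ha).eq_or_lt with rfl | ha0
  · simp only [extendToZero, lt_irrefl, if_false, hb0, if_true]
    have h2 : (0 : ℝ) < b / 2 := by linarith
    refine lt_of_le_of_lt (iInf_le _ (⟨b / 2, h2⟩ : Ioi (0 : ℝ))) ?_
    exact EReal.coe_lt_coe_iff.2 (hf h2 hb0 (by linarith))
  · simp only [extendToZero, ha0, hb0, if_true]
    exact EReal.coe_lt_coe_iff.2 (hf ha0 hb0 hab)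

theorem extendToZero_ne_top (f : ℝ → ℝ) (t : ℝ) : extendToZero f t ≠ ⊤ := by
  unfold extendToZero
  split_ifs
  · exact EReal.coe_ne_top _
  · exact ne_top_of_le_ne_top (EReal.coe_ne_top _)
      (iInf_le _ (⟨1, mem_Ioi.2 zero_lt_one⟩ : Ioi (0 : ℝ)))

theorem EReal.sum_ne_bot_iff {ι : Type*} {s : Finset ι} {g : ι → EReal} :
    ∑ i ∈ s, g i ≠ ⊥ ↔ ∀ i ∈ s, g i ≠ ⊥ := by
  classical
  induction s using Finset.induction_on with
  | empty => simp
  | insert a s ha ih =>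
    rw [Finset.sum_insert ha, Ne, EReal.add_eq_bot_iff, not_or, Finset.forall_mem_insert]
    exact and_congr Iff.rfl ih

theorem EReal.coe_finset_sum {ι : Type*} (s : Finset ι) (g : ι → ℝ) :
    ((∑ i ∈ s, g i : ℝ) : EReal) = ∑ i ∈ s, (g i : EReal) := by
  classical
  induction s using Finset.induction_on with
  | empty => simp
  | insert a s ha ih => rw [Finset.sum_insert ha, Finset.sum_insert ha, EReal.coe_add, ih]

/-- Strictness could be swallowed by a summand `⊥`. Finiteness of the smaller sum excludes this on
both sides. -/
theorem EReal.sum_lt_sum_of_ne_bot {ι : Type*} {s : Finset ι} {g h : ι → EReal}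
    (hg : ∑ i ∈ s, g i ≠ ⊥) (hh : ∀ i ∈ s, h i ≠ ⊤) (hle : ∀ i ∈ s, g i ≤ h i)
    (hlt : ∃ i ∈ s, g i < h i) : ∑ i ∈ s, g i < ∑ i ∈ s, h i := by
  have hg' := EReal.sum_ne_bot_iff.1 hg
  have e1 : ∀ i ∈ s, g i = ((g i).toReal : EReal) := fun i hi =>
    (EReal.coe_toReal (ne_top_of_le_ne_top (hh i hi) (hle i hi)) (hg' i hi)).symm
  have e2 : ∀ i ∈ s, h i = ((h i).toReal : EReal) := fun i hi =>
    (EReal.coe_toReal (hh i hi) (ne_bot_of_le_ne_bot (hg' i hi) (hle i hi))).symm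
  rw [Finset.sum_congr rfl e1, Finset.sum_congr rfl e2, ← EReal.coe_finset_sum,
    ← EReal.coe_finset_sum, EReal.coe_lt_coe_iff]
  refine Finset.sum_lt_sum (fun i hi => ?_) ?_
  · rw [← EReal.coe_le_coe_iff, ← e1 i hi, ← e2 i hi]
    exact hle i hi
  · obtain ⟨i, hi, h⟩ := hlt
    refine ⟨i, hi, ?_⟩
    rw [← EReal.coe_lt_coe_iff, ← e1 i hi, ← e2 i hi]
    exact h

theorem InextensibleClosedCurve.energy_eq_sum {n : ℕ} (f : ℝ → ℝ)
    (G : InextensibleClosedCurve n) : G.energy f =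
      ∑ x ∈ Finset.univ.sigma (fun p : Fin n => Finset.Ioi p),
        extendToZero f (dist (G.particle x.1) (G.particle x.2)) := by
  rw [Finset.sum_sigma]; rfl

/-- A closed polygon with edges of length at most one is taut if no polygon with edges of length at
most one has all distances at least as large and one of them larger. -/
structure Taut {n : ℕ} [NeZero n] (A : Fin n → Space3) : Prop where
  edge_le : ∀ i, dist (A i) (A (i + 1)) ≤ 1
  dist_le : ∀ B : Fin n → Space3, (∀ i, dist (B i) (B (i + 1)) ≤ 1) →
    (∀ p q, dist (A p) (A q) ≤ dist (B p) (B q)) → ∀ p q, dist (B p) (B q) ≤ dist (A p) (A q)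

theorem InextensibleClosedCurve.dist_particle_le {n : ℕ} [NeZero n]
    (G : InextensibleClosedCurve n) (i : Fin n) {t : ℝ} (ht : t ∈ Icc (0 : ℝ) 1) :
    dist (G.particle i) (G.toFun ((i : ℕ) + t)) ≤ t ∧
      dist (G.toFun ((i : ℕ) + t)) (G.particle (i + 1)) ≤ 1 - t := by
  have hi : (((i : ℕ) : ℝ)) + 1 ≤ n := by exact_mod_cast i.2
  have hi0 : (0 : ℝ) ≤ ((i : ℕ) : ℝ) := Nat.cast_nonneg _
  have hnext : G.particle (i + 1) = G.toFun ((i : ℕ) + 1) := by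
    rcases Nat.lt_or_ge (i.val + 1) n with h | h
    · have hval : (i + 1).val = i.val + 1 := Fin.val_add_one_of_lt' h
      simp only [InextensibleClosedCurve.particle, hval, Nat.cast_add, Nat.cast_one]
    · have hin : i.val + 1 = n := le_antisymm i.2 h
      have hval : (i + 1).val = 0 := by
        rw [Fin.val_add, Fin.val_one', Nat.add_mod_mod, hin, Nat.mod_self]
      simp only [InextensibleClosedCurve.particle, hval, Nat.cast_zero]
      rw [G.closed]
      congr 1
      exact_mod_cast hin.symm
  obtain ⟨h0, h1⟩ := ht
  constructor
  · have := G.unitSpeed.dist_le (a := (i : ℕ)) (b := (i : ℕ) + t)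
      ⟨by linarith, by linarith⟩ ⟨by linarith, by linarith⟩ (by linarith)
    rwa [add_sub_cancel_left] at this
  · rw [hnext]
    have := G.unitSpeed.dist_le (a := (i : ℕ) + t) (b := (i : ℕ) + 1)
      ⟨by linarith, by linarith⟩ ⟨by linarith, by linarith⟩ (by linarith)
    linarith

theorem taut_particle_of_energy_le {n : ℕ} [NeZero n] {f : ℝ → ℝ}
    (hf : StrictMonoOn f (Ioi 0)) {G : InextensibleClosedCurve n}
    (hG : ∀ G' : InextensibleClosedCurve n, G'.energy f ≤ G.energy f) : Taut G.particle := by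
  have hbot : G.energy f ≠ ⊥ := by
    obtain ⟨x, hx⟩ : ∃ x : Space3, ‖x‖ = 1 := by
      obtain ⟨x, hx, -⟩ := exists_unit_orthogonal 0 0
      exact ⟨x, hx⟩
    have hn : (0 : ℝ) < n := Nat.cast_pos.2 (NeZero.pos n)
    -- Distinct points on a segment shorter than `1` give a competitor of finite energy, so the
    -- maximum is not `⊥`.
    set B : Fin n → Space3 := fun i => (((i : ℕ) : ℝ) / n) • x with hBdef
    have hd : ∀ i j, dist (B i) (B j) = |((i : ℕ) : ℝ) - (j : ℕ)| / n := by
      intro i j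
      rw [dist_eq_norm, hBdef, ← sub_smul, norm_smul, hx, mul_one, Real.norm_eq_abs, ← sub_div,
        abs_div, abs_of_pos hn]
    have hB : ∀ i, dist (B i) (B (i + 1)) ≤ 1 := by
      intro i
      rw [hd, div_le_one hn, abs_le]
      have h1 : ((i : ℕ) : ℝ) ≤ n := by exact_mod_cast i.2.le
      have h2 : (((i + 1 : Fin n) : ℕ) : ℝ) ≤ n := by exact_mod_cast (i + 1).2.le
      have h3 : (0 : ℝ) ≤ ((i : ℕ) : ℝ) := Nat.cast_nonneg _
      have h4 : (0 : ℝ) ≤ (((i + 1 : Fin n) : ℕ) : ℝ) := Nat.cast_nonneg _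
      constructor <;> linarith
    obtain ⟨G', hG'⟩ := exists_curve_through hB
    refine ne_bot_of_le_ne_bot ?_ (hG G')
    rw [InextensibleClosedCurve.energy_eq_sum, EReal.sum_ne_bot_iff]
    rintro ⟨p, q⟩ hpq
    simp only [Finset.mem_sigma, Finset.mem_univ, Finset.mem_Ioi, true_and] at hpq
    have : 0 < dist (B p) (B q) := by
      rw [hd]
      refine div_pos (abs_pos.2 (sub_ne_zero.2 ?_)) hn
      exact_mod_cast (Fin.lt_def.1 hpq).ne
    simp only [hG', extendToZero, this, if_true]
    exact EReal.coe_ne_bot _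
  refine ⟨fun i => ?_, fun B hB hAB p q => ?_⟩
  · have := (G.dist_particle_le i (t := 1) (by simp)).1
    -- At `t = 1` this bound is `0`: the curve point at `i + 1` is the next particle, also when the
    -- index wraps around.
    have h2 := (G.dist_particle_le i (t := 1) (by simp)).2
    rw [sub_self] at h2
    rw [← eq_of_dist_eq_zero (le_antisymm h2 dist_nonneg)]
    exact this
  · obtain ⟨G', rfl⟩ := exists_curve_through hB
    have hmono := extendToZero_strictMonoOn hf
    wlog hpq : p < q generalizing p q
    · rcases lt_trichotomy p q with h | rfl | h
      · exact this p q h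
      · simp
      · rw [dist_comm, dist_comm (G.particle p)]
        exact this q p h
    by_contra hcon
    push Not at hcon
    refine absurd (hG G') (not_le.2 ?_)
    rw [InextensibleClosedCurve.energy_eq_sum] at hbot ⊢
    rw [InextensibleClosedCurve.energy_eq_sum]
    refine EReal.sum_lt_sum_of_ne_bot hbot (fun x _ => extendToZero_ne_top f _)
      (fun x _ => hmono.monotoneOn dist_nonneg dist_nonneg (hAB _ _)) ⟨⟨p, q⟩, by simpa using hpq, ?_⟩
    exact hmono dist_nonneg dist_nonneg hcon

/-! ### Cyclic index sets -/

section Cyclic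

variable {n : ℕ} [NeZero n]

theorem Fin.val_add_one_cases (i : Fin n) :
    (i.val + 1 < n ∧ (i + 1).val = i.val + 1) ∨ (i.val + 1 = n ∧ (i + 1).val = 0) := by
  rcases Nat.lt_or_ge (i.val + 1) n with h | h
  · exact Or.inl ⟨h, Fin.val_add_one_of_lt' h⟩
  · have hin : i.val + 1 = n := le_antisymm i.2 h
    refine Or.inr ⟨hin, ?_⟩
    rw [Fin.val_add, Fin.val_one', Nat.add_mod_mod, hin, Nat.mod_self]

theorem Fin.cyclic_induction {p : Fin n → Prop} {k : Fin n} (hk : p k)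
    (h : ∀ i, p i → p (i + 1)) (i : Fin n) : p i := by
  have key : ∀ m : ℕ, ∀ j : Fin n, j.val = m → p (k + j) := by
    intro m
    induction m with
    | zero =>
      intro j hj
      have : j = 0 := Fin.ext (by simpa using hj)
      simpa [this] using hk
    | succ m ih =>
      intro j hj
      have hm : m + 1 < n := hj ▸ j.2
      have hj' : j = (⟨m, by omega⟩ : Fin n) + 1 := by
        ext
        rw [Fin.val_add_one_of_lt' hm, hj]
      rw [hj', ← add_assoc]
      exact h _ (ih _ rfl)
  simpa using key _ (i - k) rfl

/-- A set of indices in cyclic order that is contiguous: it is left at most once and entered at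
most once. -/
structure IsCyclicInterval (S : Set (Fin n)) : Prop where
  exit_unique : ∀ ⦃k l⦄, k ∈ S → l ∈ S → k + 1 ∉ S → l + 1 ∉ S → k = l
  entry_unique : ∀ ⦃k l⦄, k ∈ S → l ∈ S → k - 1 ∉ S → l - 1 ∉ S → k = l

theorem exists_exit {S : Set (Fin n)} (h0 : S.Nonempty) (h1 : S ≠ univ) :
    ∃ k ∈ S, k + 1 ∉ S := by
  by_contra! h
  obtain ⟨k, hk⟩ := h0
  exact h1 (eq_univ_of_forall (Fin.cyclic_induction hk h))

theorem exists_entry {S : Set (Fin n)} (h0 : S.Nonempty) (h1 : S ≠ univ) :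
    ∃ k ∈ S, k - 1 ∉ S := by
  obtain ⟨k, hk, hk'⟩ := exists_exit (S := Sᶜ) (nonempty_compl.2 h1)
    (fun h => h0.ne_empty (compl_univ_iff.1 h))
  refine ⟨k + 1, not_not.1 hk', ?_⟩
  rwa [add_sub_cancel_right]

/-- Look where `S \ I` is left, at `k`. Either the next index is in `I`, hence is the unique entry
`l`, and `l - 1 = k` is in `S`; or `k` is the unique exit of `S`, which would have to be `r ∈ I` if
`r + 1 ∉ S`. -/
theorem IsCyclicInterval.mem_of_ssubset {I S : Set (Fin n)} (hI : IsCyclicInterval I)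
    (hS : IsCyclicInterval S) (hIS : I ⊂ S) {r l : Fin n} (hr : r ∈ I) (hr' : r + 1 ∉ I)
    (hl : l ∈ I) (hl' : l - 1 ∉ I) : r + 1 ∈ S \ I ∨ l - 1 ∈ S \ I := by
  by_contra! hcon
  have h1 : r + 1 ∉ S := fun h => hcon.1 ⟨h, hr'⟩
  have h2 : l - 1 ∉ S := fun h => hcon.2 ⟨h, hl'⟩
  obtain ⟨j, hjS, hjI⟩ := exists_of_ssubset hIS
  obtain ⟨k, ⟨hkS, hkI⟩, hk⟩ := exists_exit (S := S \ I) ⟨j, hjS, hjI⟩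
    (fun h => (h.symm ▸ mem_univ r : r ∈ S \ I).2 hr)
  by_cases hk1 : k + 1 ∈ S
  · have hk2 : k + 1 ∈ I := by
      by_contra h
      exact hk ⟨hk1, h⟩
    have : k + 1 = l := hI.entry_unique hk2 hl (by rwa [add_sub_cancel_right]) hl'
    rw [← this, add_sub_cancel_right] at h2
    exact h2 hkS
  · exact hkI (hS.exit_unique hkS (hIS.1 hr) hk1 h1 ▸ hr)

end Cyclic

/-! ### Reflecting an arc in a supporting plane -/

section Flip

variable {n : ℕ} [NeZero n] {A : Fin n → Space3} {u : Space3} {c : ℝ}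

theorem Taut.edge_sq_le (hA : Taut A) (i : Fin n) : ‖A i - A (i + 1)‖ ^ 2 ≤ 1 := by
  rw [← dist_eq_norm, sq_le_one_iff₀ dist_nonneg]
  exact hA.edge_le i

theorem Taut.norm_sq_le (hA : Taut A) {B : Fin n → Space3}
    (hB : ∀ i, ‖B i - B (i + 1)‖ ^ 2 ≤ 1)
    (hAB : ∀ p q, ‖A p - A q‖ ^ 2 ≤ ‖B p - B q‖ ^ 2) (p q : Fin n) :
    ‖B p - B q‖ ^ 2 ≤ ‖A p - A q‖ ^ 2 := by
  have := hA.dist_le B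
    (fun i => by rw [dist_eq_norm, ← sq_le_one_iff₀ (norm_nonneg _)]; exact hB i)
    (fun p q => by
      rw [dist_eq_norm, dist_eq_norm]
      exact (pow_le_pow_iff_left₀ (norm_nonneg _) (norm_nonneg _) two_ne_zero).1 (hAB p q)) p q
  rw [dist_eq_norm, dist_eq_norm] at this
  exact pow_le_pow_left₀ (norm_nonneg _) this 2

/-- Cyclic relabelling, which lets the later arguments start an arc at index `0`. -/
theorem Taut.shift (hA : Taut A) (a : Fin n) : Taut (fun i => A (i + a)) where
  edge_le i := by
    have := hA.edge_le (i + a)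
    rwa [add_right_comm] at this
  dist_le B hB hAB p q := by
    have h1 : ∀ i, dist (B (i - a)) (B (i + 1 - a)) ≤ 1 := fun i => by
      have := hB (i - a)
      rwa [sub_add_eq_add_sub] at this
    have h2 : ∀ p q, dist (A p) (A q) ≤ dist (B (p - a)) (B (q - a)) := fun p q => by
      simpa using hAB (p - a) (q - a)
    simpa using hA.dist_le (fun i => B (i - a)) h1 h2 (p + a) (q + a)

/-- All points lie in the half-space `⟪u, x⟫ ≤ c`. -/
def Supports (A : Fin n → Space3) (u : Space3) (c : ℝ) : Prop := ∀ i, inner ℝ u (A i) ≤ c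

/-- The indices of the points on the plane `⟪u, x⟫ = c`. -/
def contact (A : Fin n → Space3) (u : Space3) (c : ℝ) : Set (Fin n) := {i | inner ℝ u (A i) = c}

/-- The arc after `l` is reflected in the plane. Squared distances across the two arcs grow by `4 *
h i * h j / ‖u‖ ^ 2`, so tautness forces `h x * h y = 0`. -/
theorem Taut.contact_of_arcs (hA : Taut A) (hS : Supports A u c) {l x y : Fin n}
    (h0 : 0 ∈ contact A u c) (hl : l ∈ contact A u c) (hx : x ≤ l) (hy : l < y) :
    x ∈ contact A u c ∨ y ∈ contact A u c := by
  rcases eq_or_ne u 0 with rfl | hu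
  · left
    simp only [contact, mem_ofPred_eq, inner_zero_left] at h0 ⊢
    exact h0
  have hu2 : 0 < ‖u‖ ^ 2 := by positivity
  set h : Fin n → ℝ := fun i => c - inner ℝ u (A i) with hh
  have h_nonneg : ∀ i, 0 ≤ h i := fun i => sub_nonneg.2 (hS i)
  set B : Fin n → Space3 := fun i => if i ≤ l then A i else A i + (2 * h i / ‖u‖ ^ 2) • u with hB
  have hinner : ∀ i j, inner ℝ (A i - A j) u = h j - h i := fun i j => by
    rw [real_inner_comm, inner_sub_right]; simp only [hh]; ring
  have e1 : ∀ i j, i ≤ l → j ≤ l → ‖B i - B j‖ ^ 2 = ‖A i - A j‖ ^ 2 := fun i j hi hj => by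
    simp only [hB, hi, hj, if_true]
  have e2 : ∀ i j, ¬ i ≤ l → ¬ j ≤ l → ‖B i - B j‖ ^ 2 = ‖A i - A j‖ ^ 2 := fun i j hi hj => by
    simp only [hB, hi, hj, if_false]
    have : A i + (2 * h i / ‖u‖ ^ 2) • u - (A j + (2 * h j / ‖u‖ ^ 2) • u) =
        (A i - A j) + (2 * (h i - h j) / ‖u‖ ^ 2) • u := by
      module
    rw [this, norm_add_sq_real, inner_smul_right, hinner, norm_smul, mul_pow, Real.norm_eq_abs,
      sq_abs]
    field_simp
    ring
  have e3 : ∀ i j, i ≤ l → ¬ j ≤ l →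
      ‖B i - B j‖ ^ 2 = ‖A i - A j‖ ^ 2 + 4 * h i * h j / ‖u‖ ^ 2 := fun i j hi hj => by
    simp only [hB, hi, hj, if_true, if_false]
    rw [← sub_sub, norm_sub_sq_real, inner_smul_right, hinner, norm_smul, mul_pow,
      Real.norm_eq_abs, sq_abs]
    field_simp
    ring
  have e4 : ∀ i j, ¬ i ≤ l → j ≤ l →
      ‖B i - B j‖ ^ 2 = ‖A i - A j‖ ^ 2 + 4 * h j * h i / ‖u‖ ^ 2 := fun i j hi hj => by
    rw [norm_sub_rev, norm_sub_rev (A i)]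
    exact e3 j i hj hi
  have hl0 : h l = 0 := sub_eq_zero.2 (Eq.symm hl)
  have h00 : h 0 = 0 := sub_eq_zero.2 (Eq.symm h0)
  -- Only two edges join the arcs, the one leaving `l` and the one entering `0`; each has an end on
  -- the plane and keeps its length.
  have hedge : ∀ i, ‖B i - B (i + 1)‖ ^ 2 ≤ 1 := by
    intro i
    refine le_trans (le_of_eq ?_) (hA.edge_sq_le i)
    by_cases hi : i ≤ l <;> by_cases hi' : i + 1 ≤ l
    · exact e1 _ _ hi hi'
    · have : i = l := by
        rw [Fin.ext_iff]
        rw [Fin.le_def] at hi hi'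
        rcases Fin.val_add_one_cases i with h | h <;> omega
      rw [e3 _ _ hi hi', this, hl0]
      simp
    · have : i + 1 = 0 := by
        rw [Fin.ext_iff, Fin.val_zero]
        rw [Fin.le_def] at hi hi'
        rcases Fin.val_add_one_cases i with h | h <;> omega
      rw [e4 _ _ hi hi', this, h00]
      simp
    · exact e2 _ _ hi hi'
  have hge : ∀ p q, ‖A p - A q‖ ^ 2 ≤ ‖B p - B q‖ ^ 2 := by
    intro i j
    by_cases hi : i ≤ l <;> by_cases hj : j ≤ l
    · exact (e1 _ _ hi hj).ge
    · rw [e3 _ _ hi hj]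
      exact le_add_of_nonneg_right (by have := h_nonneg i; have := h_nonneg j; positivity)
    · rw [e4 _ _ hi hj]
      exact le_add_of_nonneg_right (by have := h_nonneg i; have := h_nonneg j; positivity)
    · exact (e2 _ _ hi hj).ge
  have hfin := hA.norm_sq_le hedge hge x y
  rw [e3 x y hx (not_le.2 hy)] at hfin
  have h4 : 4 * h x * h y / ‖u‖ ^ 2 ≤ 0 := by linarith
  have h5 : h x * h y = 0 := by
    have h6 : 0 ≤ h x * h y := mul_nonneg (h_nonneg x) (h_nonneg y)
    rw [div_le_iff₀ hu2] at h4
    nlinarith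
  rcases mul_eq_zero.1 h5 with h7 | h7
  · exact Or.inl (sub_eq_zero.1 h7).symm
  · exact Or.inr (sub_eq_zero.1 h7).symm

/-- Two different exits `k`, `l` would put `k + 1` and `l + 1` off the plane on opposite arcs
between the contacts `k` and `l`; similarly for entries. -/
theorem Taut.isCyclicInterval_contact (hA : Taut A) (hS : Supports A u c) :
    IsCyclicInterval (contact A u c) := by
  have key : ∀ k l x y : Fin n, k ∈ contact A u c → l ∈ contact A u c → x ≤ l - k → l - k < y →
      x + k ∈ contact A u c ∨ y + k ∈ contact A u c := by
    intro k l x y hk hl hx hy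
    refine (hA.shift k).contact_of_arcs (u := u) (c := c) (fun i => hS _) ?_ ?_ hx hy
    · simpa [contact] using hk
    · simpa [contact] using hl
  constructor
  · intro k l hk hl hk' hl'
    by_contra hkl
    have hlk : (l - k).val ≠ 0 := fun h => hkl (sub_eq_zero.1 (Fin.ext h : l - k = 0)).symm
    have hlk' : (l - k + 1).val ≠ 0 := fun h => by
      have : l - k + 1 = 0 := Fin.ext h
      have : l + 1 = k := by rw [← sub_eq_zero, ← this]; abel
      exact hl' (this ▸ hk)
    have hlt := (l - k).2
    have hx : 1 ≤ l - k := by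
      rw [Fin.le_def, Fin.val_one', Nat.mod_eq_of_lt (by omega)]
      omega
    have hy : l - k < l - k + 1 := by
      rw [Fin.lt_def]
      rcases Fin.val_add_one_cases (l - k) with h | h <;> omega
    rcases key k l 1 (l - k + 1) hk hl hx hy with h | h
    · exact hk' (by rwa [add_comm] at h)
    · exact hl' (by have e : l - k + 1 + k = l + 1 := by abel
                    rwa [e] at h)
  · intro k l hk hl hk' hl'
    by_contra hkl
    have hlk : (l - k - 1 + 1).val ≠ 0 := fun h => by
      rw [sub_add_cancel] at h
      exact hkl (sub_eq_zero.1 (Fin.ext h : l - k = 0)).symm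
    have hlk' : (l - k + 1).val ≠ 0 := fun h => by
      have : l - k + 1 = 0 := Fin.ext h
      have : l = k - 1 := by rw [← sub_eq_zero, ← this]; abel
      exact hk' (this ▸ hl)
    have hx : l - k - 1 ≤ l - k := by
      rw [Fin.le_def]
      have := Fin.val_add_one_cases (l - k - 1)
      rw [sub_add_cancel] at this hlk
      omega
    have hy : l - k < -1 := by
      rw [Fin.lt_def]
      have h1 := Fin.val_add_one_cases (-1 : Fin n)
      have h2 := Fin.val_add_one_cases (l - k)
      rw [neg_add_cancel, Fin.val_zero] at h1
      omega
    rcases key k l (l - k - 1) (-1) hk hl hx hy with h | h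
    · exact hl' (by have e : l - k - 1 + k = l - 1 := by abel
                    rwa [e] at h)
    · exact hk' (by have e : -1 + k = k - 1 := by abel
                    rwa [e] at h)

end Flip

/-! ### Tilting a supporting plane about a vertex -/

section Tilt

variable {n : ℕ} [NeZero n] {A : Fin n → Space3} {u v w : Space3} {c M : ℝ}

/-- The central projection of the points from `v` to the plane `⟪u, x - v⟫ = -1`. -/
noncomputable def vertexFigure (A : Fin n → Space3) (u v : Space3) (i : Fin n) : Space3 :=
  (inner ℝ u (v - A i))⁻¹ • (A i - v)

omit [NeZero n] in
theorem inner_pos_of_ne (hS : Supports A u c) (hv : ∀ i, i ∈ contact A u c ↔ A i = v)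
    (hc : inner ℝ u v = c) {i : Fin n} (hi : A i ≠ v) : 0 < inner ℝ u (v - A i) := by
  rw [inner_sub_right, hc]
  exact sub_pos.2 (lt_of_le_of_ne (hS i) fun h => hi ((hv i).1 h))

omit [NeZero n] in
theorem smul_vertexFigure (hS : Supports A u c) (hv : ∀ i, i ∈ contact A u c ↔ A i = v)
    (hc : inner ℝ u v = c) {i : Fin n} (hi : A i ≠ v) :
    inner ℝ u (v - A i) • vertexFigure A u v i = A i - v := by
  rw [vertexFigure, smul_smul, mul_inv_cancel₀ (inner_pos_of_ne hS hv hc hi).ne', one_smul]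

-- The position of a point relative to the tilted plane is, up to its positive height below the old
-- one, that of its projection relative to the line `⟪w, y⟫ = M`. So supporting lines of the vertex
-- figure become supporting planes through `v`.
omit [NeZero n] in
theorem tilt_aux (hS : Supports A u c) (hv : ∀ i, i ∈ contact A u c ↔ A i = v)
    (hc : inner ℝ u v = c) {i : Fin n} (hi : A i ≠ v) :
    inner ℝ (w + M • u) (A i) - inner ℝ (w + M • u) v =
      inner ℝ u (v - A i) * (inner ℝ w (vertexFigure A u v i) - M) := by
  have h1 := congrArg (fun x => inner ℝ w x) (smul_vertexFigure hS hv hc hi)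
  simp only [inner_smul_right] at h1
  rw [mul_sub, h1, ← inner_sub_right, inner_add_left, inner_smul_left, ← neg_sub (A i) v,
    inner_neg_right]
  simp only [conj_trivial]
  ring

omit [NeZero n] in
theorem supports_tilt (hS : Supports A u c) (hv : ∀ i, i ∈ contact A u c ↔ A i = v)
    (hc : inner ℝ u v = c) (hM : ∀ i, A i ≠ v → inner ℝ w (vertexFigure A u v i) ≤ M) :
    Supports A (w + M • u) (inner ℝ (w + M • u) v) := by
  intro i
  by_cases hi : A i = v
  · rw [hi]
  · rw [← sub_nonpos, tilt_aux hS hv hc hi]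
    exact mul_nonpos_of_nonneg_of_nonpos (inner_pos_of_ne hS hv hc hi).le (sub_nonpos.2 (hM i hi))

omit [NeZero n] in
theorem mem_contact_tilt (hS : Supports A u c) (hv : ∀ i, i ∈ contact A u c ↔ A i = v)
    (hc : inner ℝ u v = c) {i : Fin n} :
    i ∈ contact A (w + M • u) (inner ℝ (w + M • u) v) ↔
      A i = v ∨ A i ≠ v ∧ inner ℝ w (vertexFigure A u v i) = M := by
  by_cases hi : A i = v
  · simp [contact, hi]
  · simp only [contact, mem_ofPred_eq, hi, false_or, ne_eq, not_false_eq_true, true_and]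
    rw [← sub_eq_zero, tilt_aux hS hv hc hi, mul_eq_zero, sub_eq_zero]
    exact or_iff_right (inner_pos_of_ne hS hv hc hi).ne'

/-- The tilted plane meets the polygon in a contiguous set strictly larger than the block of indices
at `v`, so it must extend that block at one of its ends `r`, `l`. -/
theorem Taut.tilt_neighbour (hA : Taut A) (hS : Supports A u c)
    (hv : ∀ i, i ∈ contact A u c ↔ A i = v) (hc : inner ℝ u v = c)
    (hM : ∀ i, A i ≠ v → inner ℝ w (vertexFigure A u v i) ≤ M)
    (hM' : ∃ i, A i ≠ v ∧ inner ℝ w (vertexFigure A u v i) = M) {r l : Fin n} (hr : A r = v)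
    (hr' : A (r + 1) ≠ v) (hl : A l = v) (hl' : A (l - 1) ≠ v) :
    inner ℝ w (vertexFigure A u v (r + 1)) = M ∨ inner ℝ w (vertexFigure A u v (l - 1)) = M := by
  have h := (hA.isCyclicInterval_contact hS).mem_of_ssubset
    (hA.isCyclicInterval_contact (supports_tilt hS hv hc hM)) (r := r) (l := l) ?_ ((hv _).2 hr)
    (fun h => hr' ((hv _).1 h)) ((hv _).2 hl) (fun h => hl' ((hv _).1 h))
  · refine h.imp (fun h => ?_) (fun h => ?_)
    · exact (((mem_contact_tilt hS hv hc).1 h.1).resolve_left hr').2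
    · exact (((mem_contact_tilt hS hv hc).1 h.1).resolve_left hl').2
  · refine (ssubset_iff_exists).2 ⟨fun i hi => (mem_contact_tilt hS hv hc).2
      (Or.inl ((hv i).1 hi)), ?_⟩
    obtain ⟨i, hi, hi'⟩ := hM'
    exact ⟨i, (mem_contact_tilt hS hv hc).2 (Or.inr ⟨hi, hi'⟩), fun h => hi ((hv i).1 h)⟩

omit [NeZero n] in
/-- A point of largest norm is exposed. -/
theorem supports_of_norm_le {i₀ : Fin n} (h : ∀ i, ‖A i‖ ≤ ‖A i₀‖) :
    Supports A (A i₀) (inner ℝ (A i₀) (A i₀)) ∧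
      ∀ i, i ∈ contact A (A i₀) (inner ℝ (A i₀) (A i₀)) ↔ A i = A i₀ := by
  have key : ∀ i, ‖A i - A i₀‖ ^ 2 ≤ 2 * (inner ℝ (A i₀) (A i₀) - inner ℝ (A i₀) (A i)) := by
    intro i
    rw [norm_sub_sq_real, real_inner_self_eq_norm_sq, real_inner_comm]
    have := pow_le_pow_left₀ (norm_nonneg _) (h i) 2
    linarith
  refine ⟨fun i => ?_, fun i => ⟨fun hi => ?_, fun hi => ?_⟩⟩
  · have := key i
    nlinarith [sq_nonneg ‖A i - A i₀‖]
  · have h1 := key i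
    rw [show inner ℝ (A i₀) (A i) = _ from hi, sub_self, mul_zero] at h1
    have h2 : ‖A i - A i₀‖ ^ 2 = 0 := le_antisymm h1 (sq_nonneg _)
    exact sub_eq_zero.1 (norm_eq_zero.1 (pow_eq_zero_iff two_ne_zero |>.1 h2))
  · simp [contact, hi]

/-- At a point of largest norm the vertex figure has to lie on a line, since its faces compete for
only two neighbours. -/
theorem Taut.exists_normal (hA : Taut A) : ∃ z : Space3, ‖z‖ = 1 ∧ ∀ i j, inner ℝ z (A i - A j) = 0 := by
  obtain ⟨i₀, hi₀⟩ := Finite.exists_max fun i => ‖A i‖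
  obtain ⟨hS, hv⟩ := supports_of_norm_le hi₀
  set v := A i₀ with hv_def
  set y := vertexFigure A v v with hy
  suffices h : ∃ p q : Space3, ∀ i, A i ≠ v → ∃ s t : ℝ, y i = s • p + t • q by
    obtain ⟨p, q, h⟩ := h
    obtain ⟨z, hz, hpz, hqz⟩ := exists_unit_orthogonal p q
    have key : ∀ i, inner ℝ z (A i - v) = 0 := by
      intro i
      by_cases hi : A i = v
      · rw [hi, sub_self, inner_zero_right]
      · obtain ⟨s, t, hst⟩ := h i hi
        rw [← smul_vertexFigure hS hv rfl hi, ← hy, hst, inner_smul_right, inner_add_right,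
          inner_smul_right, inner_smul_right, real_inner_comm p, hpz, real_inner_comm q, hqz]
        simp
    refine ⟨z, hz, fun i j => ?_⟩
    rw [← sub_sub_sub_cancel_right (A i) (A j) v, inner_sub_right, key, key, sub_zero]
  by_cases hall : ∀ i, A i = v
  · exact ⟨0, 0, fun i hi => absurd (hall i) hi⟩
  push Not at hall
  classical
  set K := Finset.univ.filter fun i => A i ≠ v with hK
  have hKm : ∀ i, i ∈ K ↔ A i ≠ v := fun i => by simp [hK]
  have hKne : K.Nonempty := by
    obtain ⟨i, hi⟩ := hall
    exact ⟨i, (hKm i).2 hi⟩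
  obtain ⟨k₁, hk₁, hmax₁⟩ := K.exists_max_image (fun i => ‖y i‖) hKne
  obtain ⟨k₂, hk₂, hmax₂⟩ := K.exists_max_image (fun i => ‖y i - y k₁‖) hKne
  -- Three disjoint faces of a vertex figure not on a line: its longest vector `y k₁`, the point `y
  -- k₂` farthest from it, and the face extreme in the direction `w₃` orthogonal to `y k₂ - y k₁`
  -- and pointing towards a point `y k₃` off that line.
  by_contra! hcon
  obtain ⟨k₃, hk₃, hspan⟩ := hcon (y k₁) (y k₂ - y k₁)
  set d := y k₂ - y k₁ with hd
  have hd0 : d ≠ 0 := by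
    intro h
    have h1 := hmax₂ k₃ ((hKm _).2 hk₃)
    simp only [h, norm_zero] at h1
    refine hspan 1 0 ?_
    rw [one_smul, zero_smul, add_zero, ← sub_eq_zero]
    exact norm_le_zero_iff.1 h1
  have hdd : 0 < inner ℝ d d := by
    rw [real_inner_self_eq_norm_sq]
    positivity
  set e := y k₃ - y k₁ with he
  set w₃ := e - (inner ℝ d e / inner ℝ d d) • d with hw₃
  have hw₃0 : w₃ ≠ 0 := by
    intro h
    refine hspan 1 (inner ℝ d e / inner ℝ d d) ?_
    rw [one_smul, ← sub_eq_zero.1 h, he]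
    abel
  have hw₃d : inner ℝ w₃ d = 0 := by
    rw [hw₃, inner_sub_left, inner_smul_left, real_inner_comm]
    simp only [conj_trivial]
    field_simp
    ring
  have hw₃e : 0 < inner ℝ w₃ e := by
    have : inner ℝ w₃ e = inner ℝ w₃ w₃ := by
      conv_rhs => rw [hw₃, inner_sub_right, inner_smul_right, ← hw₃, hw₃d]
      ring
    rw [this, real_inner_self_eq_norm_sq]
    positivity
  obtain ⟨k₄, hk₄, hmax₄⟩ := K.exists_max_image (fun i => inner ℝ w₃ (y i)) hKne
  have hproper : {i | A i = v} ≠ univ := fun h => by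
    obtain ⟨i, hi⟩ := hall
    exact hi (h.symm ▸ mem_univ i : i ∈ {i | A i = v})
  obtain ⟨r, hr, hr'⟩ := exists_exit (S := {i | A i = v}) ⟨i₀, rfl⟩ hproper
  obtain ⟨l, hl, hl'⟩ := exists_entry (S := {i | A i = v}) ⟨i₀, rfl⟩ hproper
  -- the three faces meet the two neighbours of the block of indices at `v`
  have f₁ : ∀ i, A i ≠ v → ‖y i - y k₁‖ ^ 2 ≤ 2 * (inner ℝ (y k₁) (y k₁) - inner ℝ (y k₁) (y i)) := by
    intro i hi
    rw [norm_sub_sq_real, real_inner_self_eq_norm_sq, real_inner_comm]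
    have := pow_le_pow_left₀ (norm_nonneg _) (hmax₁ i ((hKm i).2 hi)) 2
    linarith
  have f₂ : ∀ i, A i ≠ v → ‖y i - y k₂‖ ^ 2 ≤ 2 * (inner ℝ d (y k₂) - inner ℝ d (y i)) := by
    intro i hi
    have e1 : y i - y k₂ = (y i - y k₁) - d := by rw [hd]; abel
    have e2 : inner ℝ d (y k₂) - inner ℝ d (y i) = ‖d‖ ^ 2 - inner ℝ (y i - y k₁) d := by
      rw [← real_inner_self_eq_norm_sq, real_inner_comm d (y i - y k₁), ← inner_sub_right,
        ← inner_sub_right]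
      congr 1
      conv_rhs => rw [hd]
      abel
    rw [e1, norm_sub_sq_real, e2]
    have := pow_le_pow_left₀ (norm_nonneg _) (hmax₂ i ((hKm i).2 hi)) 2
    linarith
  have g₁ := hA.tilt_neighbour (w := y k₁) (M := inner ℝ (y k₁) (y k₁)) hS hv rfl
    (fun i hi => by have := f₁ i hi; nlinarith [sq_nonneg ‖y i - y k₁‖])
    ⟨k₁, (hKm _).1 hk₁, rfl⟩ hr hr' hl hl'
  have g₂ := hA.tilt_neighbour (w := d) (M := inner ℝ d (y k₂)) hS hv rfl
    (fun i hi => by have := f₂ i hi; nlinarith [sq_nonneg ‖y i - y k₂‖])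
    ⟨k₂, (hKm _).1 hk₂, rfl⟩ hr hr' hl hl'
  have g₃ := hA.tilt_neighbour (w := w₃) (M := inner ℝ w₃ (y k₄)) hS hv rfl
    (fun i hi => hmax₄ i ((hKm _).2 hi)) ⟨k₄, (hKm _).1 hk₄, rfl⟩ hr hr' hl hl'
  rw [← hy] at g₁ g₂ g₃
  have q₁ : ∀ i, A i ≠ v → inner ℝ (y k₁) (y i) = inner ℝ (y k₁) (y k₁) → y i = y k₁ := by
    intro i hi h
    have h1 := f₁ i hi
    rw [h, sub_self, mul_zero] at h1
    exact sub_eq_zero.1 (norm_eq_zero.1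
      (pow_eq_zero_iff two_ne_zero |>.1 (le_antisymm h1 (sq_nonneg _))))
  have q₂ : ∀ i, A i ≠ v → inner ℝ d (y i) = inner ℝ d (y k₂) → y i = y k₂ := by
    intro i hi h
    have h1 := f₂ i hi
    rw [h, sub_self, mul_zero] at h1
    exact sub_eq_zero.1 (norm_eq_zero.1
      (pow_eq_zero_iff two_ne_zero |>.1 (le_antisymm h1 (sq_nonneg _))))
  have d₁₂ : y k₁ ≠ y k₂ := fun h => hd0 (by rw [hd, h, sub_self])
  have m₃ : inner ℝ w₃ (y k₁) < inner ℝ w₃ (y k₄) := by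
    have h1 := hmax₄ k₃ ((hKm _).2 hk₃)
    rw [he, inner_sub_right] at hw₃e
    linarith
  have m₃' : inner ℝ w₃ (y k₂) < inner ℝ w₃ (y k₄) := by
    rw [hd, inner_sub_right] at hw₃d
    linarith
  have t₁₂ : ∀ i, A i ≠ v → inner ℝ (y k₁) (y i) = inner ℝ (y k₁) (y k₁) →
      inner ℝ d (y i) ≠ inner ℝ d (y k₂) := fun i hi h h' =>
    d₁₂ ((q₁ i hi h).symm.trans (q₂ i hi h'))
  have t₁₃ : ∀ i, A i ≠ v → inner ℝ (y k₁) (y i) = inner ℝ (y k₁) (y k₁) →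
      inner ℝ w₃ (y i) ≠ inner ℝ w₃ (y k₄) := fun i hi h h' => by
    rw [q₁ i hi h] at h'
    exact m₃.ne h'
  have t₂₃ : ∀ i, A i ≠ v → inner ℝ d (y i) = inner ℝ d (y k₂) →
      inner ℝ w₃ (y i) ≠ inner ℝ w₃ (y k₄) := fun i hi h h' => by
    rw [q₂ i hi h] at h'
    exact m₃'.ne h'
  -- Pigeonhole: two of the three faces share one of the neighbours `r + 1`, `l - 1`.
  rcases g₁ with g₁ | g₁ <;> rcases g₂ with g₂ | g₂ <;> rcases g₃ with g₃ | g₃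
  · exact t₁₂ _ hr' g₁ g₂
  · exact t₁₂ _ hr' g₁ g₂
  · exact t₁₃ _ hr' g₁ g₃
  · exact t₂₃ _ hl' g₂ g₃
  · exact t₂₃ _ hr' g₂ g₃
  · exact t₁₃ _ hl' g₁ g₃
  · exact t₁₂ _ hl' g₁ g₂
  · exact t₁₂ _ hl' g₁ g₂

end Tilt

/-! ### All edges have length one -/

section Edges

variable {n : ℕ} [NeZero n] {A : Fin n → Space3}

/-- If `d` were the diameter, scaling by `d⁻¹` would enlarge distances and keep the edges at most
`1`. For `d = 0` all points coincide, and moving one of them to distance `1` does the same. -/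
theorem Taut.not_dist_le_of_lt (hn : 2 ≤ n) (hA : Taut A) {d : ℝ} (hd : d < 1)
    {a b : Fin n} (hab : dist (A a) (A b) = d) : ∃ p q, d < dist (A p) (A q) := by
  by_contra! hall
  have hd0 : 0 ≤ d := hab ▸ dist_nonneg
  rcases hd0.eq_or_lt with rfl | hd0
  · obtain ⟨x, hx, -⟩ := exists_unit_orthogonal 0 0
    have hB : ∀ p q : Fin n, dist (if p = 0 then x else 0) (if q = 0 then x else 0) ≤ 1 := by
      intro p q
      split_ifs <;> simp [hx]
    have h1 := hA.dist_le (fun i => if i = 0 then x else 0) (fun i => hB _ _)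
      (fun p q => (hall p q).trans dist_nonneg) 0 ⟨1, by omega⟩
    have h2 : (⟨1, by omega⟩ : Fin n) ≠ 0 := by simp [Fin.ext_iff]
    simp only [if_true, h2, if_false, dist_zero_right, hx] at h1
    linarith [hall 0 ⟨1, by omega⟩]
  · have hdist : ∀ p q, dist (d⁻¹ • A p) (d⁻¹ • A q) = d⁻¹ * dist (A p) (A q) := fun p q => by
      rw [dist_smul₀, Real.norm_eq_abs, abs_of_pos (inv_pos.2 hd0)]
    have h1 := hA.dist_le (fun i => d⁻¹ • A i)
      (fun i => by
        rw [hdist, inv_mul_le_one₀ hd0]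
        exact hall _ _)
      (fun p q => by
        rw [hdist]
        exact le_mul_of_one_le_left dist_nonneg ((one_le_inv₀ hd0).2 hd.le)) a b
    rw [hdist, hab, inv_mul_cancel₀ hd0.ne'] at h1
    linarith

theorem dist_le_of_mem_segment {E : Type*} [SeminormedAddCommGroup E] [NormedSpace ℝ E]
    {a b x y : E} (hx : x ∈ segment ℝ a b) (hy : y ∈ segment ℝ a b) : dist x y ≤ dist a b := by
  rw [segment_eq_image_lineMap] at hx hy
  obtain ⟨s, hs, rfl⟩ := hx
  obtain ⟨t, ht, rfl⟩ := hy
  rw [dist_lineMap_lineMap, Real.dist_eq]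
  refine mul_le_of_le_one_left dist_nonneg ?_
  rw [abs_le]
  constructor <;> linarith [hs.1, hs.2, ht.1, ht.2]

/-- Turning the second part of an open chain about a supporting line, out of the plane, does not
decrease any distance, so that it contradicts tautness if the closing edge has slack. -/
theorem Taut.no_hinge (hA : Taut A) {u z : Space3} {c : ℝ} (hu : ‖u‖ = 1) (hz : ‖z‖ = 1)
    (huz : inner ℝ u z = 0) (hzA : ∀ i j, inner ℝ z (A i - A j) = 0) (hS : Supports A u c)
    {q : Fin n} (hq : q ∈ contact A u c) (h0 : 0 ∉ contact A u c) (h1 : -1 ∉ contact A u c) :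
    1 ≤ ‖A 0 - A (-1)‖ ^ 2 := by
  by_contra! hd
  set h : Fin n → ℝ := fun i => c - inner ℝ u (A i) with hh
  have h_nonneg : ∀ i, 0 ≤ h i := fun i => sub_nonneg.2 (hS i)
  have hh0 : 0 < h 0 := sub_pos.2 (lt_of_le_of_ne (hS 0) h0)
  have hh1 : 0 < h (-1) := sub_pos.2 (lt_of_le_of_ne (hS (-1)) h1)
  have hhq : h q = 0 := sub_eq_zero.2 (Eq.symm hq)
  -- `D` is one minus the cosine of the turning angle, small enough for the growth `2 * D * h 0 * h
  -- (-1)` of the closing edge to fit into its slack.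
  set D : ℝ := min 1 ((1 - ‖A 0 - A (-1)‖ ^ 2) / (2 * h 0 * h (-1))) with hD
  have hpos : 0 < 2 * h 0 * h (-1) := by positivity
  have hD0 : 0 < D := lt_min one_pos (div_pos (by linarith) hpos)
  have hD1 : D ≤ 1 := min_le_left _ _
  have hD2 : 2 * D * h 0 * h (-1) ≤ 1 - ‖A 0 - A (-1)‖ ^ 2 := by
    have := (le_div_iff₀ hpos).1 (hD ▸ min_le_right 1 _)
    linarith
  have hsq : Real.sqrt (2 * D - D ^ 2) ^ 2 = 2 * D - D ^ 2 := Real.sq_sqrt (by nlinarith)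
  -- A point at depth `h` below the line moves by `h • k`; this is a rotation because `‖k - u‖ = 1`.
  set k : Space3 := D • u + Real.sqrt (2 * D - D ^ 2) • z with hk
  have hk2 : ‖k‖ ^ 2 = 2 * D := by
    rw [hk, norm_add_sq_real, inner_smul_left, inner_smul_right, huz, norm_smul, norm_smul, hu, hz,
      mul_one, mul_one, Real.norm_eq_abs, Real.norm_eq_abs, sq_abs, sq_abs, hsq]
    ring
  have hinner : ∀ i j, inner ℝ (A i - A j) k = D * (h j - h i) := fun i j => by
    rw [real_inner_comm, hk, inner_add_left, inner_smul_left, inner_smul_left, hzA, inner_sub_right]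
    simp only [hh, conj_trivial]
    ring
  set B : Fin n → Space3 := fun i => if i ≤ q then A i else A i + h i • k with hB
  have e1 : ∀ i j, i ≤ q → j ≤ q → ‖B i - B j‖ ^ 2 = ‖A i - A j‖ ^ 2 := fun i j hi hj => by
    simp only [hB, hi, hj, if_true]
  have e2 : ∀ i j, ¬ i ≤ q → ¬ j ≤ q → ‖B i - B j‖ ^ 2 = ‖A i - A j‖ ^ 2 := fun i j hi hj => by
    simp only [hB, hi, hj, if_false]
    have : A i + h i • k - (A j + h j • k) = (A i - A j) + (h i - h j) • k := by module
    rw [this, norm_add_sq_real, inner_smul_right, hinner, norm_smul, mul_pow, Real.norm_eq_abs,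
      sq_abs, hk2]
    ring
  have e3 : ∀ i j, i ≤ q → ¬ j ≤ q →
      ‖B i - B j‖ ^ 2 = ‖A i - A j‖ ^ 2 + 2 * D * h i * h j := fun i j hi hj => by
    simp only [hB, hi, hj, if_true, if_false]
    rw [← sub_sub, norm_sub_sq_real, inner_smul_right, hinner, norm_smul, mul_pow,
      Real.norm_eq_abs, sq_abs, hk2]
    ring
  have e4 : ∀ i j, ¬ i ≤ q → j ≤ q →
      ‖B i - B j‖ ^ 2 = ‖A i - A j‖ ^ 2 + 2 * D * h j * h i := fun i j hi hj => by
    rw [norm_sub_rev, norm_sub_rev (A i)]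
    exact e3 j i hj hi
  have hm1 := Fin.val_add_one_cases (-1 : Fin n)
  rw [neg_add_cancel, Fin.val_zero] at hm1
  have hqlt : ¬ (-1 : Fin n) ≤ q := by
    intro hle
    have : q = -1 := by
      rw [Fin.le_def] at hle
      rw [Fin.ext_iff]
      omega
    exact hh1.ne' (this ▸ hhq)
  have h0q : (0 : Fin n) ≤ q := Fin.zero_le _
  have hedge : ∀ i, ‖B i - B (i + 1)‖ ^ 2 ≤ 1 := by
    intro i
    by_cases hi : i ≤ q <;> by_cases hi' : i + 1 ≤ q
    · rw [e1 _ _ hi hi']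
      exact hA.edge_sq_le i
    · have : i = q := by
        rw [Fin.ext_iff]
        rw [Fin.le_def] at hi hi'
        rcases Fin.val_add_one_cases i with h | h <;> omega
      rw [e3 _ _ hi hi', this, hhq, mul_zero, zero_mul, add_zero]
      exact hA.edge_sq_le q
    · have hi0 : i + 1 = 0 := by
        rw [Fin.ext_iff, Fin.val_zero]
        rw [Fin.le_def] at hi hi'
        rcases Fin.val_add_one_cases i with h | h <;> omega
      rw [eq_neg_of_add_eq_zero_left hi0, neg_add_cancel, e4 _ _ hqlt h0q, norm_sub_rev]
      linarith
    · rw [e2 _ _ hi hi']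
      exact hA.edge_sq_le i
  have hge : ∀ p q, ‖A p - A q‖ ^ 2 ≤ ‖B p - B q‖ ^ 2 := by
    intro i j
    by_cases hi : i ≤ q <;> by_cases hj : j ≤ q
    · exact (e1 _ _ hi hj).ge
    · rw [e3 _ _ hi hj]
      exact le_add_of_nonneg_right (by have := h_nonneg i; have := h_nonneg j; positivity)
    · rw [e4 _ _ hi hj]
      exact le_add_of_nonneg_right (by have := h_nonneg i; have := h_nonneg j; positivity)
    · exact (e2 _ _ hi hj).ge
  have hfin := hA.norm_sq_le hedge hge 0 (-1)
  rw [e3 _ _ h0q hqlt] at hfin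
  have : 0 < 2 * D * h 0 * h (-1) := by positivity
  linarith

/-- Some distance exceeds the short closing edge, so some point lies off that segment. A line
separating the two, moved to support the polygon, misses both ends and serves as the hinge. -/
theorem Taut.one_le_dist_closing (hn : 2 ≤ n) (hA : Taut A) : 1 ≤ dist (A 0) (A (-1)) := by
  by_contra! hlt
  obtain ⟨z, hz, hzA⟩ := hA.exists_normal
  obtain ⟨p, q, hpq⟩ := hA.not_dist_le_of_lt hn hlt rfl
  obtain ⟨i₀, hi₀⟩ : ∃ i, A i ∉ segment ℝ (A 0) (A (-1)) := by
    by_contra! hall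
    exact absurd (dist_le_of_mem_segment (hall p) (hall q)) (not_le.2 hpq)
  have hclosed : IsClosed (segment ℝ (A 0) (A (-1))) := by
    rw [segment_eq_image_lineMap]
    exact (isCompact_Icc.image AffineMap.lineMap_continuous).isClosed
  obtain ⟨f, b, hf1, hf2⟩ := geometric_hahn_banach_closed_point
    (convex_segment (A 0) (A (-1))) hclosed hi₀
  set u₀ : Space3 := (InnerProductSpace.toDual ℝ Space3).symm f with hu₀
  have hfu : ∀ x, inner ℝ u₀ x = f x := fun x => InnerProductSpace.toDual_symm_apply
  -- Removing the normal component does not change inner products with differences of vertices.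
  set u₁ : Space3 := u₀ - (inner ℝ z u₀ : ℝ) • z with hu₁
  have hu₁A : ∀ i j, inner ℝ u₁ (A i - A j) = f (A i) - f (A j) := fun i j => by
    rw [hu₁, inner_sub_left, inner_smul_left, hzA, mul_zero, sub_zero, hfu, map_sub]
  have hu₁z : inner ℝ u₁ z = 0 := by
    rw [hu₁, inner_sub_left, inner_smul_left, real_inner_self_eq_norm_sq, hz, real_inner_comm]
    simp
  have hf0 := hf1 _ (left_mem_segment ℝ (A 0) (A (-1)))
  have hf1' := hf1 _ (right_mem_segment ℝ (A 0) (A (-1)))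
  have hu₁0 : 0 < ‖u₁‖ := by
    rw [norm_pos_iff]
    intro h
    have := hu₁A i₀ 0
    rw [h, inner_zero_left] at this
    linarith
  set u : Space3 := ‖u₁‖⁻¹ • u₁ with hu
  obtain ⟨q, hq⟩ := Finite.exists_max fun i => inner ℝ u (A i)
  have huA : ∀ i j, inner ℝ u (A i) - inner ℝ u (A j) = ‖u₁‖⁻¹ * (f (A i) - f (A j)) :=
    fun i j => by
      rw [← inner_sub_right, hu, inner_smul_left, hu₁A]
      simp
  have hstrict : ∀ j, f (A j) < b → j ∉ contact A u (inner ℝ u (A q)) := by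
    intro j hj hmem
    have h1 := hq i₀
    have h2 := huA i₀ j
    have h3 : 0 < ‖u₁‖⁻¹ * (f (A i₀) - f (A j)) := mul_pos (inv_pos.2 hu₁0) (by linarith)
    have h4 : inner ℝ u (A j) = inner ℝ u (A q) := hmem
    linarith
  have := hA.no_hinge (u := u) (z := z) (c := inner ℝ u (A q)) (q := q)
    (by rw [hu, norm_smul, norm_inv, norm_norm, inv_mul_cancel₀ hu₁0.ne']) hz
    (by rw [hu, inner_smul_left, hu₁z, mul_zero]) hzA hq rfl (hstrict _ hf0) (hstrict _ hf1')
  rw [← dist_eq_norm] at this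
  nlinarith [dist_nonneg (x := A 0) (y := A (-1))]

theorem Taut.dist_eq_one (hn : 2 ≤ n) (hA : Taut A) (i : Fin n) : dist (A i) (A (i + 1)) = 1 := by
  refine le_antisymm (hA.edge_le i) ?_
  have := (hA.shift (i + 1)).one_le_dist_closing hn
  have e : -1 + (i + 1) = i := by abel
  rwa [zero_add, e, dist_comm] at this

end Edges

/-! ### Arcs on a supporting line run monotonically -/

section Chain

variable {n : ℕ} [NeZero n] {A : Fin n → Space3}

theorem OrthonormalBasis.norm_sq_eq_three (b : OrthonormalBasis (Fin 3) ℝ Space3) (x : Space3) :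
    ‖x‖ ^ 2 = inner ℝ (b 0) x ^ 2 + inner ℝ (b 1) x ^ 2 + inner ℝ (b 2) x ^ 2 := by
  rw [← b.sum_sq_norm_inner_right x, Fin.sum_univ_three]
  simp only [Real.norm_eq_abs, sq_abs]

/-- Lifting a planar configuration towards another one into the third dimension. -/
theorem Taut.eq_of_lift (hA : Taut A) (b : OrthonormalBasis (Fin 3) ℝ Space3)
    (hz : ∀ i j, inner ℝ (b 2) (A i - A j) = 0) {x y c d : Fin n → ℝ}
    (hx : ∀ i, inner ℝ (b 0) (A i) = x i) (hy : ∀ i, inner ℝ (b 1) (A i) = y i)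
    (hedge : ∀ i, (y i - y (i + 1)) * (d i - d (i + 1)) = 0 ∧
      (c i - c (i + 1)) ^ 2 + (d i - d (i + 1)) ^ 2 = (x i - x (i + 1)) ^ 2)
    (hpair : ∀ i j, 0 < (y i - y j) * (d i - d j) ∨ (y i - y j) * (d i - d j) = 0 ∧
      (x i - x j) ^ 2 ≤ (c i - c j) ^ 2 + (d i - d j) ^ 2)
    {p q : Fin n} (hpq : (y p - y q) * (d p - d q) = 0) :
    (c p - c q) ^ 2 + (d p - d q) ^ 2 ≤ (x p - x q) ^ 2 := by
  have hev : ∀ i j, ∀ᶠ τ : ℝ in nhdsWithin 0 (Ioi 0),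
      0 ≤ τ ^ 2 * ((c i - c j) ^ 2 + (d i - d j) ^ 2 - (x i - x j) ^ 2) +
        2 * τ * ((y i - y j) * (d i - d j)) := by
    intro i j
    rcases hpair i j with h | ⟨h, h'⟩
    · have hcont : Filter.Tendsto (fun τ : ℝ =>
          τ * ((c i - c j) ^ 2 + (d i - d j) ^ 2 - (x i - x j) ^ 2) +
            2 * ((y i - y j) * (d i - d j))) (nhdsWithin 0 (Ioi 0))
          (nhds (2 * ((y i - y j) * (d i - d j)))) := by
        refine tendsto_nhdsWithin_of_tendsto_nhds ?_
        exact Continuous.tendsto' (by fun_prop) _ _ (by simp)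
      filter_upwards [hcont.eventually (lt_mem_nhds (by linarith :
        0 < 2 * ((y i - y j) * (d i - d j)))), self_mem_nhdsWithin] with τ h1 h2
      have := mul_pos (show (0 : ℝ) < τ from h2) h1
      linarith
    · filter_upwards with τ
      rw [h, mul_zero, add_zero]
      exact mul_nonneg (sq_nonneg _) (by linarith)
  have hev1 : ∀ᶠ τ : ℝ in nhdsWithin 0 (Ioi 0), τ < 1 :=
    nhdsWithin_le_nhds (gt_mem_nhds one_pos)
  obtain ⟨τ, ⟨hτ, hτ1⟩, hτ0⟩ := (((Filter.eventually_all.2 fun i => Filter.eventually_all.2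
    fun j => hev i j).and hev1).and self_mem_nhdsWithin).exists
  have hτ0' : 0 < τ := hτ0
  set σ := Real.sqrt (1 - τ ^ 2) with hσ
  have hσ2 : σ ^ 2 = 1 - τ ^ 2 := Real.sq_sqrt (by nlinarith)
  -- With `σ ^ 2 + τ ^ 2 = 1`, the first and third coordinates contribute `σ ^ 2 * Δx ^ 2 + τ ^ 2 *
  -- Δc ^ 2` to a squared distance. The second contributes `2 * τ * Δy * Δd` to first order, which
  -- dominates for small `τ` when it is positive.
  set B : Fin n → Space3 := fun i =>
    (σ ^ 2 * x i + τ ^ 2 * c i) • b 0 + (y i + τ * d i) • b 1 + (σ * τ * (x i - c i)) • b 2 with hB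
  have hon := b.orthonormal
  have h00 : ∀ i, inner ℝ (b i) (b i) = 1 := fun i => by
    rw [real_inner_self_eq_norm_sq, hon.1, one_pow]
  have h01 : ∀ {i j}, i ≠ j → inner ℝ (b i) (b j) = 0 := fun h => hon.2 h
  have hB0 : ∀ i, inner ℝ (b 0) (B i) = σ ^ 2 * x i + τ ^ 2 * c i := fun i => by
    simp only [hB, inner_add_right, inner_smul_right, h00]
    rw [h01 (by decide), h01 (by decide)]; ring
  have hB1 : ∀ i, inner ℝ (b 1) (B i) = y i + τ * d i := fun i => by
    simp only [hB, inner_add_right, inner_smul_right, h00]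
    rw [h01 (by decide), h01 (by decide)]; ring
  have hB2 : ∀ i, inner ℝ (b 2) (B i) = σ * τ * (x i - c i) := fun i => by
    simp only [hB, inner_add_right, inner_smul_right, h00]
    rw [h01 (by decide), h01 (by decide)]; ring
  have hdA : ∀ i j, ‖A i - A j‖ ^ 2 = (x i - x j) ^ 2 + (y i - y j) ^ 2 := fun i j => by
    rw [b.norm_sq_eq_three, hz, inner_sub_right, inner_sub_right, hx, hx, hy, hy]
    ring
  have hdB : ∀ i j, ‖B i - B j‖ ^ 2 = ‖A i - A j‖ ^ 2 +
      (τ ^ 2 * ((c i - c j) ^ 2 + (d i - d j) ^ 2 - (x i - x j) ^ 2) +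
        2 * τ * ((y i - y j) * (d i - d j))) := fun i j => by
    rw [hdA, b.norm_sq_eq_three, inner_sub_right, inner_sub_right, inner_sub_right, hB0, hB0, hB1,
      hB1, hB2, hB2]
    have h1 : (σ * τ * (x i - c i) - σ * τ * (x j - c j)) ^ 2 =
        σ ^ 2 * (τ ^ 2 * (x i - c i - (x j - c j)) ^ 2) := by ring
    rw [h1, hσ2]
    ring
  have hfin := hA.norm_sq_le (B := B)
    (fun i => by
      rw [hdB, (hedge i).1, (hedge i).2]
      have := hA.edge_sq_le i
      linarith)
    (fun i j => by
      rw [hdB]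
      exact le_add_of_nonneg_right (hτ i j)) p q
  rw [hdB, hpq] at hfin
  have hτ2 : 0 < τ ^ 2 := by positivity
  by_contra! hcon
  have := mul_pos hτ2 (sub_pos.2 hcon)
  linarith

/-- A triangle with base `P + Q - s` and sides `P + s`, `Q` exists because its strict triangle
inequalities follow from `s < P` and `s < Q`. The vectors `g`, `e` point from the ends of the base
to the apex `(κ, η)`. -/
theorem exists_triangle {P Q s : ℝ} (hs : 0 < s) (hP : s < P) (hQ : s < Q) :
    ∃ g₁ g₂ e₁ e₂ : ℝ, g₁ ^ 2 + g₂ ^ 2 = 1 ∧ e₁ ^ 2 + e₂ ^ 2 = 1 ∧ 0 < g₂ ∧ 0 < e₂ ∧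
      (P + s) * g₁ = P + Q - s + Q * e₁ ∧ (P + s) * g₂ = Q * e₂ := by
  set L := P + Q - s with hL
  have hL0 : 0 < L := by linarith
  have hPs : 0 < P + s := by linarith
  have hQ0 : 0 < Q := by linarith
  set κ := ((P + s) ^ 2 + L ^ 2 - Q ^ 2) / (2 * L) with hκ
  have hκL : 2 * L * κ = (P + s) ^ 2 + L ^ 2 - Q ^ 2 := by rw [hκ]; field_simp
  have h1 : 0 < P + s - κ := by
    have : 0 < 2 * L * (P + s - κ) := by
      have e : 2 * L * (P + s - κ) = 4 * s * (Q - s) := by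
        rw [mul_sub, hκL, hL]; ring
      rw [e]; exact mul_pos (by linarith) (by linarith)
    exact pos_of_mul_pos_right this (by linarith)
  have h2 : 0 < P + s + κ := by
    have : 0 < 2 * L * (P + s + κ) := by
      have e : 2 * L * (P + s + κ) = 4 * P * (P + Q) := by
        rw [mul_add, hκL, hL]; ring
      rw [e]; exact mul_pos (by linarith) (by linarith)
    exact pos_of_mul_pos_right this (by linarith)
  have h3 : 0 < (P + s) ^ 2 - κ ^ 2 := by nlinarith
  set η := Real.sqrt ((P + s) ^ 2 - κ ^ 2) with hη
  have hη0 : 0 < η := Real.sqrt_pos.2 h3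
  have hη2 : η ^ 2 = (P + s) ^ 2 - κ ^ 2 := Real.sq_sqrt h3.le
  refine ⟨κ / (P + s), η / (P + s), (κ - L) / Q, η / Q, ?_, ?_, div_pos hη0 hPs,
    div_pos hη0 hQ0, ?_, ?_⟩
  · field_simp
    linarith
  · field_simp
    nlinarith
  · field_simp
    ring
  · field_simp

/-- The arc between the two ends of the points on a supporting line runs monotonically. -/
theorem Taut.le_of_chain (hA : Taut A) (b : OrthonormalBasis (Fin 3) ℝ Space3) {c₀ : ℝ}
    (hz : ∀ i j, inner ℝ (b 2) (A i - A j) = 0) (hS : Supports A (b 1) c₀) {m : Fin n}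
    (hm : ∀ i ≤ m, i ∈ contact A (b 1) c₀)
    (hx0 : ∀ i ∈ contact A (b 1) c₀, inner ℝ (b 0) (A 0) ≤ inner ℝ (b 0) (A i))
    (hxm : ∀ i ∈ contact A (b 1) c₀, inner ℝ (b 0) (A i) ≤ inner ℝ (b 0) (A m))
    (hx0' : ∀ i, 0 < i → i < m → inner ℝ (b 0) (A 0) < inner ℝ (b 0) (A i))
    (hxm' : ∀ i, 0 < i → i < m → inner ℝ (b 0) (A i) < inner ℝ (b 0) (A m))
    {i j : Fin n} (hij : i ≤ j) (hj : j ≤ m) : inner ℝ (b 0) (A i) ≤ inner ℝ (b 0) (A j) := by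
  classical
  by_contra! hdrop
  set x : Fin n → ℝ := fun i => inner ℝ (b 0) (A i) - inner ℝ (b 0) (A 0) with hx
  -- The largest backward run, from `j` to `k`, is the piece to unfold.
  obtain ⟨⟨j, k⟩, hjk, hmax⟩ := (Finset.univ.filter fun t : Fin n × Fin n =>
    t.1 ≤ t.2 ∧ t.2 ≤ m).exists_max_image (fun t => x t.1 - x t.2)
    ⟨(i, j), by simp [hij, hj]⟩
  simp only [Finset.mem_filter, Finset.mem_univ, true_and] at hjk hmax
  obtain ⟨hjk, hkm⟩ := hjk
  have hdrop' : ∀ p q, p ≤ q → q ≤ m → x p - x q ≤ x j - x k := fun p q h1 h2 =>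
    hmax (p, q) ⟨h1, h2⟩
  have hs : 0 < x j - x k := lt_of_lt_of_le (by simp only [hx]; linarith) (hdrop' _ _ hij hj)
  clear hdrop hij hj hmax i
  have x0 : x 0 = 0 := sub_self _
  have hx_nonneg : ∀ i ∈ contact A (b 1) c₀, 0 ≤ x i := fun i hi => sub_nonneg.2 (hx0 i hi)
  have hx_le : ∀ i ∈ contact A (b 1) c₀, x i ≤ x m := fun i hi => sub_le_sub_right (hxm i hi) _
  have hx_pos : ∀ i, 0 < i → i < m → 0 < x i := fun i h h' => sub_pos.2 (hx0' i h h')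
  have hx_lt : ∀ i, 0 < i → i < m → x i < x m := fun i h h' => sub_lt_sub_right (hxm' i h h') _
  have hjk' : j < k := lt_of_le_of_ne hjk fun h => by rw [h, sub_self] at hs; exact hs.false
  have h0j : 0 < j := (Fin.zero_le j).lt_of_ne fun h => by
    have := hx_nonneg k (hm k hkm)
    rw [← h, x0] at hs
    linarith
  have hkm' : k < m := lt_of_le_of_ne hkm fun h => by
    have := hx_le j (hm j (hjk.trans hkm))
    rw [h] at hs
    linarith
  have hjm : j < m := hjk'.trans hkm'
  have h0k : 0 < k := h0j.trans hjk'
  set P := x j with hP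
  set L := x m with hL
  set s := x j - x k with hs_def
  set Q := L - x k with hQ
  have hsP : s < P := by have := hx_pos k h0k hkm'; linarith
  have hsQ : s < Q := by have := hx_lt j h0j hjm; linarith
  have hP0 : 0 < P := by linarith
  have hQ0 : 0 < Q := by linarith
  have hLeq : L = P + Q - s := by rw [hs_def, hQ]; ring
  have hL0 : 0 < L := by linarith
  obtain ⟨g₁, g₂, e₁, e₂, hg, he, hg₂, he₂, hK₁, hK₂⟩ := exists_triangle hs hsP hsQ
  rw [← hLeq] at hK₁
  -- The new shape `(c, d)`: along `g` up to `j`, straight on along `g` with the piece from `j` to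
  -- `k` reflected, which reaches the apex at `k`, then down the other side to `(L, 0)`. All later
  -- indices stay.
  set c : Fin n → ℝ := fun i => if i ≤ j then x i * g₁ else if i ≤ k then (2 * P - x i) * g₁ else
    if i ≤ m then L + (L - x i) * e₁ else x i with hc
  set d : Fin n → ℝ := fun i => if i ≤ j then x i * g₂ else if i ≤ k then (2 * P - x i) * g₂ else
    if i ≤ m then (L - x i) * e₂ else 0 with hd
  have hdiff : ∀ p q, inner ℝ (b 0) (A p) - inner ℝ (b 0) (A q) = x p - x q := fun p q =>
    (sub_sub_sub_cancel_right _ _ _).symm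
  have c1 : ∀ i ≤ j, c i = x i * g₁ ∧ d i = x i * g₂ := fun i hi => by simp [hc, hd, hi]
  have c2 : ∀ i, j ≤ i → i ≤ k → c i = (2 * P - x i) * g₁ ∧ d i = (2 * P - x i) * g₂ := by
    intro i hi hi'
    rcases hi.eq_or_lt with rfl | hi
    · rw [(c1 j le_rfl).1, (c1 j le_rfl).2]
      constructor <;> ring
    · simp [hc, hd, not_le.2 hi, hi']
  have c3 : ∀ i, k ≤ i → i ≤ m → c i = L + (L - x i) * e₁ ∧ d i = (L - x i) * e₂ := by
    intro i hi hi'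
    rcases hi.eq_or_lt with rfl | hi
    · rw [(c2 k hjk le_rfl).1, (c2 k hjk le_rfl).2]
      constructor
      · linear_combination hK₁
      · linear_combination hK₂
    · simp [hc, hd, not_le.2 hi, not_le.2 (hjk'.trans hi), hi']
  have c4 : ∀ i, m < i → c i = x i ∧ d i = 0 := fun i hi => by
    simp [hc, hd, not_le.2 hi, not_le.2 (hkm'.trans hi), not_le.2 (hjm.trans hi)]
  have c0 : c 0 = x 0 ∧ d 0 = 0 := by
    rw [(c1 0 h0j.le).1, (c1 0 h0j.le).2, x0]; simp
  have cm : c m = x m ∧ d m = 0 := by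
    rw [(c3 m hkm le_rfl).1, (c3 m hkm le_rfl).2]
    constructor <;> ring
  clear_value x P L s Q c d
  have hg1 : g₁ ≤ 1 := by nlinarith
  have he1 : -1 ≤ e₁ := by nlinarith
  have hge : g₁ * e₁ + g₂ * e₂ ≤ 1 := by nlinarith [sq_nonneg (g₁ - e₁), sq_nonneg (g₂ - e₂)]
  -- on the chain no distance decreases
  have key : ∀ p q, p ≤ q → q ≤ m → (x p - x q) ^ 2 ≤ (c p - c q) ^ 2 + (d p - d q) ^ 2 := by
    intro p q hpq hq
    have hxp := hx_nonneg p (hm p (hpq.trans hq))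
    have hxq := hx_le q (hm q hq)
    rcases le_total q j with hqj | hqj
    · rw [(c1 p (hpq.trans hqj)).1, (c1 p (hpq.trans hqj)).2, (c1 q hqj).1, (c1 q hqj).2]
      refine le_of_eq ?_
      linear_combination -(x p - x q) ^ 2 * hg
    rcases le_total q k with hqk | hqk
    · rw [(c2 q hqj hqk).1, (c2 q hqj hqk).2]
      rcases le_total p j with hpj | hpj
      · rw [(c1 p hpj).1, (c1 p hpj).2]
        -- The drop from `p` to `k` is at most that from `j` to `k`, so `x p ≤ x j`.
        have h1 : 0 ≤ P - x p := by
          have := hdrop' p k (hpj.trans hjk) hkm; linarith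
        have h2 : 0 ≤ P - x q := by
          have := hdrop' q k hqk hkm; linarith
        have h3 := mul_nonneg h1 h2
        have : (x p * g₁ - (2 * P - x q) * g₁) ^ 2 + (x p * g₂ - (2 * P - x q) * g₂) ^ 2 =
            (x p - (2 * P - x q)) ^ 2 := by
          linear_combination (x p - (2 * P - x q)) ^ 2 * hg
        rw [this]
        linarith
      · rw [(c2 p hpj (hpq.trans hqk)).1, (c2 p hpj (hpq.trans hqk)).2]
        refine le_of_eq ?_
        linear_combination -(x p - x q) ^ 2 * hg
    · rw [(c3 q hqk hq).1, (c3 q hqk hq).2]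
      rcases le_total k p with hpk | hpk
      · rw [(c3 p hpk (hpq.trans hq)).1, (c3 p hpk (hpq.trans hq)).2]
        refine le_of_eq ?_
        linear_combination -(x p - x q) ^ 2 * he
      have h2 : 0 ≤ x q - x k := by
        have := hdrop' j q hqj hq; linarith
      rcases le_total p j with hpj | hpj
      · rw [(c1 p hpj).1, (c1 p hpj).2]
        have h1 : 0 ≤ P - x p := by
          have := hdrop' p k (hpj.trans hjk) hkm; linarith
        set r := L - x q with hr
        have hr0 : 0 ≤ r := by linarith
        have hrQ : 0 ≤ Q - r := by linarith
        -- the difference vanishes when both points are at the corners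
        have hcorner : P * L * (1 - g₁) + Q * L * (1 + e₁) =
            P * Q * (1 + (g₁ * e₁ + g₂ * e₂)) := by
          have h5 : (P * g₁ - L - Q * e₁) ^ 2 + (P * g₂ - Q * e₂) ^ 2 = s ^ 2 := by
            have e5 : P * g₁ - L - Q * e₁ = -s * g₁ := by linear_combination hK₁
            have e6 : P * g₂ - Q * e₂ = -s * g₂ := by linear_combination hK₂
            rw [e5, e6]
            linear_combination s ^ 2 * hg
          have h6 : s = P + Q - L := by linarith
          rw [h6] at h5
          linear_combination (1 / 2) * h5 - (P ^ 2 / 2) * hg - (Q ^ 2 / 2) * he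
        -- Writing `x` for `x p`, the gain is `2 * x * L * (1 - g₁) + 2 * r * L * (1 + e₁) - 2 * x *
        -- r * (1 + g₁ * e₁ + g₂ * e₂)`. Eliminating the last coefficient by `hcorner` leaves a sum
        -- of nonnegative terms.
        have hD : P * Q * ((x p * g₁ - (L + r * e₁)) ^ 2 + (x p * g₂ - r * e₂) ^ 2 -
            (x p - x q) ^ 2) = 2 * (x p * P * L * (1 - g₁) * (Q - r) +
              r * Q * L * (1 + e₁) * (P - x p)) := by
          have hxq' : x q = L - r := by rw [hr]; ring
          rw [hxq']
          linear_combination (2 * x p * r) * hcorner + P * Q * x p ^ 2 * hg + P * Q * r ^ 2 * he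
        have hD0 : 0 ≤ 2 * (x p * P * L * (1 - g₁) * (Q - r) +
              r * Q * L * (1 + e₁) * (P - x p)) := by
          have := sub_nonneg.2 hg1
          have : 0 ≤ 1 + e₁ := by linarith
          positivity
        rw [← hD] at hD0
        have := nonneg_of_mul_nonneg_right hD0 (mul_pos hP0 hQ0)
        linarith
      · rw [(c2 p hpj hpk).1, (c2 p hpj hpk).2]
        have h1 : 0 ≤ x p - x k := by
          have := hdrop' j p hpj (hpq.trans hq); linarith
        have h3 := mul_nonneg (mul_nonneg h1 h2) (sub_nonneg.2 hge)
        -- Both points are measured from the apex, where the two sides meet.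
        have e5 : (2 * P - x p) * g₁ - (L + (L - x q) * e₁) =
            (x q - x k) * e₁ - (x p - x k) * g₁ := by
          linear_combination hK₁ - g₁ * hs_def + g₁ * hP + e₁ * hQ
        have e6 : (2 * P - x p) * g₂ - (L - x q) * e₂ =
            (x q - x k) * e₂ - (x p - x k) * g₂ := by
          linear_combination hK₂ - g₂ * hs_def + g₂ * hP + e₂ * hQ
        rw [e5, e6]
        have e7 : ((x q - x k) * e₁ - (x p - x k) * g₁) ^ 2 +
            ((x q - x k) * e₂ - (x p - x k) * g₂) ^ 2 = (x p - x q) ^ 2 +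
            2 * ((x p - x k) * (x q - x k) * (1 - (g₁ * e₁ + g₂ * e₂))) := by
          linear_combination (x q - x k) ^ 2 * he + (x p - x k) ^ 2 * hg
        rw [e7]
        linarith
  have d_nonneg : ∀ i, i ≤ m → (0 < d i) ∨ (c i = x i ∧ d i = 0) := by
    intro i hi
    rcases (Fin.zero_le i).eq_or_lt with rfl | h0i
    · exact Or.inr c0
    rcases hi.eq_or_lt with rfl | him
    · exact Or.inr cm
    left
    have hx1 := hx_pos i h0i him
    have hx2 := hx_lt i h0i him
    rcases le_total i j with hij | hij
    · rw [(c1 i hij).2]; exact mul_pos hx1 hg₂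
    rcases le_total i k with hik | hik
    · rw [(c2 i hij hik).2]
      have := hdrop' i k hik hkm
      exact mul_pos (by linarith) hg₂
    · rw [(c3 i hik hi).2]; exact mul_pos (by linarith) he₂
  set y : Fin n → ℝ := fun i => inner ℝ (b 1) (A i) with hy
  have hy' : ∀ i, i ∈ contact A (b 1) c₀ → y i = c₀ := fun i hi => hi
  have hout : ∀ p q, p ≤ m → m < q → 0 < (y p - y q) * (d p - d q) ∨
      (y p - y q) * (d p - d q) = 0 ∧ (x p - x q) ^ 2 ≤ (c p - c q) ^ 2 + (d p - d q) ^ 2 := by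
    intro p q hp hq
    rw [(c4 q hq).1, (c4 q hq).2, sub_zero, hy' p (hm p hp)]
    by_cases hqc : q ∈ contact A (b 1) c₀
    · right
      rw [hy' q hqc]
      refine ⟨by ring, ?_⟩
      have h1 := key 0 p (Fin.zero_le _) hp
      have h2 := key p m hp le_rfl
      rw [c0.1, c0.2, x0] at h1
      rw [cm.1, cm.2, ← hL] at h2
      have h3 := hx_nonneg q hqc
      have h4 := hx_le q hqc
      -- Stewart's relation: the gain towards a fixed point between `0` and `L` is the weighted mean
      -- of the gains towards these two ends.
      have h5 : 0 ≤ (L - x q) * ((0 - c p) ^ 2 + (0 - d p) ^ 2 - (0 - x p) ^ 2) +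
          x q * ((c p - L) ^ 2 + (d p - 0) ^ 2 - (x p - L) ^ 2) :=
        add_nonneg (mul_nonneg (by linarith) (by linarith)) (mul_nonneg h3 (by linarith))
      have h6 : 0 ≤ L * ((c p - x q) ^ 2 + (d p) ^ 2 - (x p - x q) ^ 2) := by
        refine h5.trans (le_of_eq ?_)
        ring
      have := nonneg_of_mul_nonneg_right h6 hL0
      linarith
    · have hlt : 0 < c₀ - y q := sub_pos.2 (lt_of_le_of_ne (hS q) hqc)
      rcases d_nonneg p hp with h | ⟨h, h'⟩
      · exact Or.inl (mul_pos hlt h)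
      · right
        rw [h, h']
        exact ⟨mul_zero _, by nlinarith⟩
  have hin : ∀ p q, p ≤ m → q ≤ m → (y p - y q) * (d p - d q) = 0 := fun p q hp hq => by
    rw [hy' p (hm p hp), hy' q (hm q hq), sub_self, zero_mul]
  have hfin := hA.eq_of_lift b hz (x := fun i => inner ℝ (b 0) (A i)) (y := y) (c := c) (d := d)
    (fun i => rfl) (fun i => rfl) (p := 0) (q := k) ?_ ?_ (hin _ _ (Fin.zero_le _) hkm)
  -- The contradiction: the distance from `0` to `k` grows from `P - s` to `P + s`.
  · have hk2 : (0 - x k) ^ 2 < (c 0 - c k) ^ 2 + (d 0 - d k) ^ 2 := by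
      rw [c0.1, c0.2, x0, (c2 k hjk le_rfl).1, (c2 k hjk le_rfl).2]
      have e : (0 - (2 * P - x k) * g₁) ^ 2 + (0 - (2 * P - x k) * g₂) ^ 2 =
          (0 - x k) ^ 2 + 4 * P * s := by
        have : (0 - (2 * P - x k) * g₁) ^ 2 + (0 - (2 * P - x k) * g₂) ^ 2 =
          (2 * P - x k) ^ 2 := by linear_combination (2 * P - x k) ^ 2 * hg
        rw [this, hs_def, ← hP]
        ring
      rw [e]
      have := mul_pos hP0 hs
      linarith
    simp only [hdiff, x0] at hfin
    linarith
  · intro p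
    simp only [hdiff]
    have hfix : ∀ p q, (c p = x p ∧ d p = 0) → (c q = x q ∧ d q = 0) →
        (y p - y q) * (d p - d q) = 0 ∧
          (c p - c q) ^ 2 + (d p - d q) ^ 2 = (x p - x q) ^ 2 := by
      rintro p q ⟨h1, h2⟩ ⟨h3, h4⟩
      rw [h1, h2, h3, h4]
      constructor <;> ring
    rcases Fin.val_add_one_cases p with ⟨-, h⟩ | ⟨hn, h⟩
    · rcases lt_trichotomy p m with hpm | rfl | hpm
      · have hpm1 : p + 1 ≤ m := by rw [Fin.le_def]; rw [Fin.lt_def] at hpm; omega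
        refine ⟨hin _ _ hpm.le hpm1, ?_⟩
        rcases lt_or_ge p j with hpj | hpj
        · have h1 : p + 1 ≤ j := by rw [Fin.le_def]; rw [Fin.lt_def] at hpj; omega
          rw [(c1 _ hpj.le).1, (c1 _ hpj.le).2, (c1 _ h1).1, (c1 _ h1).2]
          linear_combination (x p - x (p + 1)) ^ 2 * hg
        have hpp : p ≤ p + 1 := by rw [Fin.le_def]; omega
        rcases lt_or_ge p k with hpk | hpk
        · have h1 : p + 1 ≤ k := by rw [Fin.le_def]; rw [Fin.lt_def] at hpk; omega
          rw [(c2 _ hpj hpk.le).1, (c2 _ hpj hpk.le).2, (c2 _ (hpj.trans hpp) h1).1,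
            (c2 _ (hpj.trans hpp) h1).2]
          linear_combination (x p - x (p + 1)) ^ 2 * hg
        · rw [(c3 _ hpk hpm.le).1, (c3 _ hpk hpm.le).2, (c3 _ (hpk.trans hpp) hpm1).1,
            (c3 _ (hpk.trans hpp) hpm1).2]
          linear_combination (x p - x (p + 1)) ^ 2 * he
      · exact hfix _ _ cm (c4 _ (by rw [Fin.lt_def]; omega))
      · exact hfix _ _ (c4 _ hpm) (c4 _ (by rw [Fin.lt_def] at hpm ⊢; omega))
    · have hp0 : p + 1 = 0 := Fin.ext h
      rw [hp0]
      refine hfix _ _ ?_ c0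
      rcases lt_trichotomy p m with hpm | rfl | hpm
      · rw [Fin.lt_def] at hpm
        have := m.2
        omega
      · exact cm
      · exact c4 _ hpm
  · intro p q
    simp only [hdiff]
    rcases le_or_gt p m with hp | hp <;> rcases le_or_gt q m with hq | hq
    · refine Or.inr ⟨hin _ _ hp hq, ?_⟩
      rcases le_total p q with hpq | hpq
      · exact key _ _ hpq hq
      · have := key _ _ hpq hp
        linarith
    · exact hout p q hp hq
    · have e1 : (y p - y q) * (d p - d q) = (y q - y p) * (d q - d p) := by ring
      have e2 : (x p - x q) ^ 2 = (x q - x p) ^ 2 := by ring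
      have e3 : (c p - c q) ^ 2 + (d p - d q) ^ 2 = (c q - c p) ^ 2 + (d q - d p) ^ 2 := by ring
      rw [e1, e2, e3]
      exact hout q p hq hp
    · right
      rw [(c4 p hp).1, (c4 p hp).2, (c4 q hq).1, (c4 q hq).2]
      constructor
      · ring
      · nlinarith

end Chain

/-! ### Supporting lines and the edges on them -/

section Faces

variable {n : ℕ} [NeZero n] {A : Fin n → Space3}

theorem exists_orthonormalBasis_eq {e u z : Space3} (he : ‖e‖ = 1) (hu : ‖u‖ = 1) (hz : ‖z‖ = 1)
    (heu : inner ℝ e u = 0) (hez : inner ℝ e z = 0) (huz : inner ℝ u z = 0) :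
    ∃ b : OrthonormalBasis (Fin 3) ℝ Space3, b 0 = e ∧ b 1 = u ∧ b 2 = z := by
  have hon : Orthonormal ℝ ![e, u, z] := by
    constructor
    · intro i
      fin_cases i <;> simp [he, hu, hz]
    · intro i j hij
      fin_cases i <;> fin_cases j <;> first
        | exact absurd rfl hij
        | simpa using heu
        | simpa using hez
        | simpa using huz
        | (rw [real_inner_comm]; simpa using heu)
        | (rw [real_inner_comm]; simpa using hez)
        | (rw [real_inner_comm]; simpa using huz)
  obtain ⟨b, hb⟩ := Orthonormal.exists_orthonormalBasis_extension_of_card_eq (ι := Fin 3)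
    (v := ![e, u, z]) (s := univ) (by simp) (hon.comp _ Subtype.val_injective)
  exact ⟨b, by simpa using hb 0 (mem_univ _), by simpa using hb 1 (mem_univ _),
    by simpa using hb 2 (mem_univ _)⟩

/-- An orthonormal frame adapted to a planar polygon and a supporting line: `b 2` is normal to
the plane, `b 1` is the outer normal of the line, and `b 0` is its direction. -/
structure LineFrame (A : Fin n → Space3) (S : Set (Fin n)) (b : OrthonormalBasis (Fin 3) ℝ Space3)
    (c : ℝ) : Prop where
  normal : ∀ i j, inner ℝ (b 2) (A i - A j) = 0
  supports : Supports A (b 1) c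
  contact_eq : contact A (b 1) c = S

variable {S : Set (Fin n)} {b : OrthonormalBasis (Fin 3) ℝ Space3} {c : ℝ}

-- Reversing the line exchanges minima and maxima, so statements about one give the other.
omit [NeZero n] in
theorem LineFrame.exists_neg (h : LineFrame A S b c) :
    ∃ b' : OrthonormalBasis (Fin 3) ℝ Space3, b' 0 = -b 0 ∧ b' 1 = b 1 ∧ LineFrame A S b' c := by
  have hon := b.orthonormal
  obtain ⟨b', h0, h1, h2⟩ := exists_orthonormalBasis_eq (e := -b 0) (u := b 1) (z := b 2)
    (by rw [norm_neg, hon.1]) (hon.1 1) (hon.1 2)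
    (by rw [inner_neg_left, hon.2 (by decide), neg_zero])
    (by rw [inner_neg_left, hon.2 (by decide), neg_zero]) (hon.2 (by decide))
  exact ⟨b', h0, h1, by rw [h2]; exact h.normal, by rw [h1]; exact h.supports,
    by rw [h1]; exact h.contact_eq⟩

omit [NeZero n] in
theorem LineFrame.sub_eq (h : LineFrame A S b c) {i j : Fin n} (hi : i ∈ S) (hj : j ∈ S) :
    A i - A j = (inner ℝ (b 0) (A i) - inner ℝ (b 0) (A j)) • b 0 := by
  have h1 : inner ℝ (b 1) (A i - A j) = 0 := by
    rw [← h.contact_eq] at hi hj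
    rw [inner_sub_right, show inner ℝ (b 1) (A i) = c from hi,
      show inner ℝ (b 1) (A j) = c from hj, sub_self]
  conv_lhs => rw [← b.sum_repr' (A i - A j)]
  rw [Fin.sum_univ_three, h1, h.normal, inner_sub_right]
  simp

omit [NeZero n] in
theorem LineFrame.dist_eq (h : LineFrame A S b c) {i j : Fin n} (hi : i ∈ S) (hj : j ∈ S) :
    dist (A i) (A j) = |inner ℝ (b 0) (A i) - inner ℝ (b 0) (A j)| := by
  rw [dist_eq_norm, h.sub_eq hi hj, norm_smul, b.orthonormal.1, mul_one, Real.norm_eq_abs]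

omit [NeZero n] in
/-- The points of a supporting plane that are extreme in direction `w` are a face. -/
theorem exists_supports_of_face {u w : Space3} {M : ℝ} (hS : Supports A u c)
    (hM : ∀ i ∈ contact A u c, inner ℝ w (A i) ≤ M) :
    ∃ u' c', Supports A u' c' ∧ ∀ i, i ∈ contact A u' c' ↔ i ∈ contact A u c ∧ inner ℝ w (A i) = M := by
  have hev : ∀ i, ∀ᶠ ε : ℝ in nhdsWithin 0 (Ioi 0), i ∉ contact A u c →
      inner ℝ u (A i) + ε * inner ℝ w (A i) < c + ε * M := by
    intro i
    by_cases hi : i ∈ contact A u c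
    · exact Filter.Eventually.of_forall fun ε h => absurd hi h
    · have hlt : inner ℝ u (A i) < c := lt_of_le_of_ne (hS i) hi
      have hcont : Filter.Tendsto (fun ε : ℝ => c + ε * M - (inner ℝ u (A i) +
          ε * inner ℝ w (A i))) (nhdsWithin 0 (Ioi 0)) (nhds (c - inner ℝ u (A i))) := by
        refine tendsto_nhdsWithin_of_tendsto_nhds ?_
        exact Continuous.tendsto' (by fun_prop) _ _ (by simp)
      filter_upwards [hcont.eventually (lt_mem_nhds (sub_pos.2 hlt))] with ε hε _
      linarith
  obtain ⟨ε, hε, hε0⟩ := ((Filter.eventually_all.2 hev).and self_mem_nhdsWithin).exists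
  have hε0' : 0 < ε := hε0
  have hin : ∀ i, inner ℝ (u + ε • w) (A i) = inner ℝ u (A i) + ε * inner ℝ w (A i) := fun i => by
    rw [inner_add_left, inner_smul_left]; simp
  refine ⟨u + ε • w, c + ε * M, fun i => ?_, fun i => ⟨fun hi => ?_, fun hi => ?_⟩⟩
  · rw [hin]
    by_cases hi : i ∈ contact A u c
    · exact add_le_add (hS i) (mul_le_mul_of_nonneg_left (hM i hi) hε0'.le)
    · exact (hε i hi).le
  · have hi' : inner ℝ u (A i) + ε * inner ℝ w (A i) = c + ε * M := by rw [← hin]; exact hi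
    by_cases hc : i ∈ contact A u c
    · refine ⟨hc, mul_left_cancel₀ hε0'.ne' ?_⟩
      have : inner ℝ u (A i) = c := hc
      linarith
    · exact absurd hi' (hε i hc).ne
  · have : inner ℝ u (A i) = c := hi.1
    change inner ℝ (u + ε • w) (A i) = _
    rw [hin, this, hi.2]

theorem Taut.ne_succ (hn : 2 ≤ n) (hA : Taut A) (i : Fin n) : A i ≠ A (i + 1) := fun h => by
  have := hA.dist_eq_one hn i
  rw [h, dist_self] at this
  exact zero_ne_one this

/-- Consecutive points differ, so every index in the contact set is an exit, and exits are unique.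
-/
theorem Taut.contact_subsingleton (hn : 2 ≤ n) (hA : Taut A) {u : Space3} (hS : Supports A u c)
    {v : Space3} (hv : ∀ i ∈ contact A u c, A i = v) : (contact A u c).Subsingleton := by
  have hexit : ∀ i ∈ contact A u c, i + 1 ∉ contact A u c := fun i hi hi' =>
    hA.ne_succ hn i ((hv i hi).trans (hv _ hi').symm)
  intro i hi j hj
  exact (hA.isCyclicInterval_contact hS).exit_unique hi hj (hexit i hi) (hexit j hj)

/-- `i` is the only index in some supporting plane. -/
def IsExposedVertex (A : Fin n → Space3) (i : Fin n) : Prop :=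
  ∃ u c, Supports A u c ∧ contact A u c = {i}

/-- The indices in a supporting plane that does not contain all the points. -/
def IsProperFace (A : Fin n → Space3) (S : Set (Fin n)) : Prop :=
  ∃ u c, Supports A u c ∧ contact A u c = S ∧ S ≠ univ

/-- Tilting the plane slightly isolates the points of lowest coordinate. They coincide in space,
hence are a single index. -/
theorem LineFrame.exposed_of_min (h : LineFrame A S b c) (hn : 2 ≤ n) (hA : Taut A) {a : Fin n}
    (ha : a ∈ S) (hmin : ∀ k ∈ S, inner ℝ (b 0) (A a) ≤ inner ℝ (b 0) (A k)) :
    IsExposedVertex A a ∧ ∀ k ∈ S, k ≠ a → inner ℝ (b 0) (A a) < inner ℝ (b 0) (A k) := by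
  obtain ⟨u', c', hS', hiff⟩ := exists_supports_of_face (w := -b 0)
    (M := -inner ℝ (b 0) (A a)) h.supports (fun i hi => by
      rw [inner_neg_left]
      exact neg_le_neg (hmin i (h.contact_eq ▸ hi)))
  simp only [h.contact_eq, inner_neg_left, neg_inj] at hiff
  have hsub := hA.contact_subsingleton hn hS' (v := A a) fun i hi => by
    obtain ⟨h1, h2⟩ := (hiff i).1 hi
    rw [← sub_eq_zero, h.sub_eq h1 ha, h2, sub_self, zero_smul]
  have ha' := (hiff a).2 ⟨ha, rfl⟩
  refine ⟨⟨u', c', hS', eq_singleton_iff_unique_mem.2 ⟨ha', fun k hk => hsub hk ha'⟩⟩, ?_⟩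
  intro k hk hka
  exact lt_of_le_of_ne (hmin k hk) fun he => hka (hsub ((hiff k).2 ⟨hk, he.symm⟩) ha')

theorem LineFrame.exposed_of_max (h : LineFrame A S b c) (hn : 2 ≤ n) (hA : Taut A) {a : Fin n}
    (ha : a ∈ S) (hmax : ∀ k ∈ S, inner ℝ (b 0) (A k) ≤ inner ℝ (b 0) (A a)) :
    IsExposedVertex A a ∧ ∀ k ∈ S, k ≠ a → inner ℝ (b 0) (A k) < inner ℝ (b 0) (A a) := by
  obtain ⟨b', h0, -, h'⟩ := h.exists_neg
  have := h'.exposed_of_min hn hA ha (fun k hk => by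
    rw [h0, inner_neg_left, inner_neg_left]
    exact neg_le_neg (hmax k hk))
  refine ⟨this.1, fun k hk hka => ?_⟩
  have := this.2 k hk hka
  rw [h0, inner_neg_left, inner_neg_left] at this
  exact neg_lt_neg_iff.1 this

/-- An arc between the ends of a supporting line runs strictly monotonically. -/
theorem LineFrame.strictMono (h : LineFrame A S b c) (hn : 2 ≤ n) (hA : Taut A) {a m : Fin n}
    (hm : ∀ t ≤ m, t + a ∈ S)
    (hmin : ∀ k ∈ S, inner ℝ (b 0) (A a) ≤ inner ℝ (b 0) (A k))
    (hmax : ∀ k ∈ S, inner ℝ (b 0) (A k) ≤ inner ℝ (b 0) (A (m + a)))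
    {i j : Fin n} (hij : i < j) (hj : j ≤ m) :
    inner ℝ (b 0) (A (i + a)) < inner ℝ (b 0) (A (j + a)) := by
  have haS : a ∈ S := by simpa using hm 0 (Fin.zero_le _)
  have hmS : m + a ∈ S := hm m le_rfl
  have hmin' := (h.exposed_of_min hn hA haS hmin).2
  have hmax' := (h.exposed_of_max hn hA hmS hmax).2
  have hcont : ∀ k, k ∈ contact (fun i => A (i + a)) (b 1) c ↔ k + a ∈ S := fun k => by
    rw [← h.contact_eq]; rfl
  have key : ∀ {i j : Fin n}, i ≤ j → j ≤ m →
      inner ℝ (b 0) (A (i + a)) ≤ inner ℝ (b 0) (A (j + a)) := by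
    intro i j hij hj
    refine (hA.shift a).le_of_chain b (c₀ := c) (m := m) (fun i j => h.normal _ _)
      (fun i => h.supports _) (fun i hi => (hcont i).2 (hm i hi)) ?_ ?_ ?_ ?_ hij hj
    · intro k hk
      simpa using hmin _ ((hcont k).1 hk)
    · intro k hk
      simpa using hmax _ ((hcont k).1 hk)
    · intro k hk hk'
      simpa using hmin' (k + a) (hm k hk'.le) (fun e => hk.ne' (by simpa using e))
    · intro k hk hk'
      simpa using hmax' (k + a) (hm k hk'.le) (fun e => hk'.ne (by simpa using e))
  have hi1 : (i + 1).val = i.val + 1 := Fin.val_add_one_of_lt' (by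
    rw [Fin.lt_def] at hij
    have := j.2
    omega)
  have h1 : i ≤ i + 1 := by rw [Fin.le_def]; omega
  have h2 : i + 1 ≤ j := by rw [Fin.le_def]; rw [Fin.lt_def] at hij; omega
  -- A first step of zero length is impossible, so one strict step followed by weak monotonicity
  -- suffices.
  refine lt_of_lt_of_le (lt_of_le_of_ne (key h1 (h2.trans hj)) fun he => ?_) (key h2 hj)
  have h3 := h.sub_eq (hm i (hij.le.trans hj)) (hm (i + 1) (h2.trans hj))
  rw [he, sub_self, zero_smul, sub_eq_zero, add_right_comm] at h3
  exact hA.ne_succ hn _ h3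

/-- The vertex figure has two distinct points, hence disjoint faces in the directions `w` and `-w`.
Each contains one of the two neighbours, and not the same one. -/
theorem Taut.exists_two_faces (hn : 2 ≤ n) (hA : Taut A) (hcol : ¬ Collinear ℝ (range A))
    {i : Fin n} (hi : IsExposedVertex A i) : ∃ S₁ S₂, IsProperFace A S₁ ∧ IsProperFace A S₂ ∧
      i ∈ S₁ ∧ i ∈ S₂ ∧ i + 1 ∈ S₁ ∧ i - 1 ∈ S₂ ∧ ∀ k ∈ S₁, k ∈ S₂ → k = i := by
  obtain ⟨u, c, hS, hc⟩ := hi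
  set v := A i with hv_def
  have hiv : inner ℝ u v = c := by
    have : i ∈ contact A u c := hc ▸ mem_singleton i
    exact this
  have hv : ∀ k, k ∈ contact A u c ↔ A k = v := by
    intro k
    constructor
    · intro hk
      rw [hc, mem_singleton_iff] at hk
      rw [hk]
    · intro hk
      change inner ℝ u (A k) = c
      rw [hk, hiv]
  have hne : ∀ k, A k = v → k = i := fun k hk => by
    have := (hv k).2 hk
    rwa [hc, mem_singleton_iff] at this
  set y := vertexFigure A u v with hy
  obtain ⟨k, l, hk, hl, hkl⟩ : ∃ k l, A k ≠ v ∧ A l ≠ v ∧ y k ≠ y l := by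
    by_contra! hall
    refine hcol ((collinear_iff_of_mem (p₀ := v) (mem_range_self i)).2 ?_)
    by_cases hv0 : ∃ k₀, A k₀ ≠ v
    · obtain ⟨k₀, hk₀⟩ := hv0
      refine ⟨y k₀, ?_⟩
      rintro _ ⟨k, rfl⟩
      by_cases hk : A k = v
      · exact ⟨0, by simp [hk]⟩
      · refine ⟨inner ℝ u (v - A k), ?_⟩
        rw [← hall k k₀ hk hk₀, hy, smul_vertexFigure hS hv hiv hk]
        simp
    · push Not at hv0
      refine ⟨0, ?_⟩
      rintro _ ⟨k, rfl⟩
      exact ⟨0, by simp [hv0 k]⟩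
  classical
  set K := Finset.univ.filter fun i => A i ≠ v with hK
  have hKm : ∀ i, i ∈ K ↔ A i ≠ v := fun i => by simp [hK]
  have hKne : K.Nonempty := ⟨k, (hKm k).2 hk⟩
  set w := y k - y l with hw
  obtain ⟨k₁, hk₁, hmax₁⟩ := K.exists_max_image (fun i => inner ℝ w (y i)) hKne
  obtain ⟨k₂, hk₂, hmax₂⟩ := K.exists_max_image (fun i => inner ℝ (-w) (y i)) hKne
  rw [hKm] at hk₁ hk₂
  have hlt : -inner ℝ (-w) (y k₂) < inner ℝ w (y k₁) := by
    have h1 := hmax₁ k ((hKm k).2 hk)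
    have h2 := hmax₂ l ((hKm l).2 hl)
    have h3 : 0 < inner ℝ w w := by
      rw [real_inner_self_eq_norm_sq]
      have := sub_ne_zero.2 hkl
      positivity
    rw [inner_neg_left, inner_neg_left] at h2
    rw [inner_neg_left]
    conv at h3 => rw [hw, inner_sub_right, ← hw]
    linarith
  have hM₁ : ∀ j, A j ≠ v → inner ℝ w (y j) ≤ inner ℝ w (y k₁) :=
    fun j hj => hmax₁ j ((hKm j).2 hj)
  have hM₂ : ∀ j, A j ≠ v → inner ℝ (-w) (y j) ≤ inner ℝ (-w) (y k₂) :=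
    fun j hj => hmax₂ j ((hKm j).2 hj)
  have hr' : A (i + 1) ≠ v := (hA.ne_succ hn i).symm
  have hl' : A (i - 1) ≠ v := by
    have := hA.ne_succ hn (i - 1)
    rwa [sub_add_cancel] at this
  have g₁ := hA.tilt_neighbour (w := w) (M := inner ℝ w (y k₁)) hS hv hiv hM₁ ⟨k₁, hk₁, rfl⟩ rfl hr' rfl hl'
  have g₂ := hA.tilt_neighbour (w := -w) (M := inner ℝ (-w) (y k₂)) hS hv hiv hM₂ ⟨k₂, hk₂, rfl⟩ rfl hr' rfl hl'
  have s₁ := supports_tilt hS hv hiv hM₁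
  have s₂ := supports_tilt hS hv hiv hM₂
  have m₁ : ∀ {j}, _ := fun {j} =>
    mem_contact_tilt (w := w) (M := inner ℝ w (y k₁)) (i := j) hS hv hiv
  have m₂ : ∀ {j}, _ := fun {j} =>
    mem_contact_tilt (w := -w) (M := inner ℝ (-w) (y k₂)) (i := j) hS hv hiv
  rw [← hy] at g₁ g₂ m₁ m₂
  set C₁ := contact A (w + inner ℝ w (y k₁) • u) (inner ℝ (w + inner ℝ w (y k₁) • u) v)
  set C₂ := contact A (-w + inner ℝ (-w) (y k₂) • u) (inner ℝ (-w + inner ℝ (-w) (y k₂) • u) v)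
  have hdis : ∀ j ∈ C₁, j ∈ C₂ → j = i := by
    intro j h1 h2
    by_contra hj
    have hjv : A j ≠ v := fun h => hj (hne j h)
    have e1 := ((m₁.1 h1).resolve_left hjv).2
    have e2 := ((m₂.1 h2).resolve_left hjv).2
    rw [← e1, ← e2, inner_neg_left, neg_neg] at hlt
    exact hlt.false
  have p₁ : IsProperFace A C₁ := ⟨_, _, s₁, rfl, fun h => by
    have := hdis k₂ (h ▸ mem_univ _) (m₂.2 (Or.inr ⟨hk₂, rfl⟩))
    exact hk₂ (by rw [this])⟩
  have p₂ : IsProperFace A C₂ := ⟨_, _, s₂, rfl, fun h => by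
    have := hdis k₁ (m₁.2 (Or.inr ⟨hk₁, rfl⟩)) (h ▸ mem_univ _)
    exact hk₁ (by rw [this])⟩
  have i₁ : i ∈ C₁ := m₁.2 (Or.inl rfl)
  have i₂ : i ∈ C₂ := m₂.2 (Or.inl rfl)
  rcases g₁ with g₁ | g₁ <;> rcases g₂ with g₂ | g₂
  · rw [inner_neg_left] at g₂
    linarith
  · exact ⟨C₁, C₂, p₁, p₂, i₁, i₂, m₁.2 (Or.inr ⟨hr', g₁⟩), m₂.2 (Or.inr ⟨hl', g₂⟩), hdis⟩
  · exact ⟨C₂, C₁, p₂, p₁, i₂, i₁, m₂.2 (Or.inr ⟨hr', g₂⟩), m₁.2 (Or.inr ⟨hl', g₁⟩),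
      fun j h2 h1 => hdis j h1 h2⟩
  · rw [inner_neg_left] at g₂
    linarith

-- The component of `u` normal to the plane of the polygon is removed. What is left is nonzero
-- because some index is off the face.
omit [NeZero n] in
theorem IsProperFace.exists_lineFrame (hS : IsProperFace A S) (hne : S.Nonempty) {z : Space3}
    (hz : ‖z‖ = 1) (hzA : ∀ i j, inner ℝ z (A i - A j) = 0) : ∃ b c, LineFrame A S b c := by
  obtain ⟨u, c, hsup, rfl, huniv⟩ := hS
  obtain ⟨i, hi⟩ := hne
  obtain ⟨j, hj⟩ := (ne_univ_iff_exists_notMem _).1 huniv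
  set u₁ : Space3 := u - (inner ℝ z u : ℝ) • z with hu₁
  have hu₁A : ∀ i j, inner ℝ u₁ (A i - A j) = inner ℝ u (A i - A j) := fun i j => by
    rw [hu₁, inner_sub_left, inner_smul_left, hzA, mul_zero, sub_zero]
  have hu₁z : inner ℝ u₁ z = 0 := by
    rw [hu₁, inner_sub_left, inner_smul_left, real_inner_self_eq_norm_sq, hz, real_inner_comm]
    simp
  have hpos : 0 < ‖u₁‖ := by
    rw [norm_pos_iff]
    intro h
    have h1 := hu₁A i j
    rw [h, inner_zero_left, inner_sub_right, show inner ℝ u (A i) = c from hi] at h1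
    exact hj (sub_eq_zero.1 h1.symm).symm
  obtain ⟨e, he, heu, hez⟩ := exists_unit_orthogonal u₁ z
  obtain ⟨b, -, hb1, hb2⟩ := exists_orthonormalBasis_eq (e := e) (u := ‖u₁‖⁻¹ • u₁) (z := z) he
    (by rw [norm_smul, norm_inv, norm_norm, inv_mul_cancel₀ hpos.ne']) hz
    (by rw [inner_smul_right, real_inner_comm, heu, mul_zero]) (by rw [real_inner_comm, hez])
    (by rw [inner_smul_left, hu₁z, mul_zero])
  have hdiff : ∀ k, inner ℝ (b 1) (A k) - inner ℝ (b 1) (A i) =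
      ‖u₁‖⁻¹ * (inner ℝ u (A k) - c) := fun k => by
    rw [← inner_sub_right, hb1, inner_smul_left, hu₁A, inner_sub_right,
      show inner ℝ u (A i) = c from hi]
    simp
  refine ⟨b, inner ℝ (b 1) (A i), by rw [hb2]; exact hzA, fun k => ?_, ?_⟩
  · rw [← sub_nonpos, hdiff]
    exact mul_nonpos_of_nonneg_of_nonpos (inv_nonneg.2 hpos.le) (sub_nonpos.2 (hsup k))
  · ext k
    simp only [contact, mem_ofPred_eq]
    rw [← sub_eq_zero, hdiff, mul_eq_zero, sub_eq_zero]
    exact or_iff_right (inv_ne_zero hpos.ne')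

theorem LineFrame.isCyclicInterval (h : LineFrame A S b c) (hA : Taut A) : IsCyclicInterval S :=
  h.contact_eq ▸ hA.isCyclicInterval_contact h.supports

/-- The lowest point on a proper supporting line is the first or the last of its arc. -/
theorem LineFrame.end_of_min (h : LineFrame A S b c) (hn : 2 ≤ n) (hA : Taut A)
    (hcol : ¬ Collinear ℝ (range A)) {a : Fin n} (ha : a ∈ S)
    (hmin : ∀ k ∈ S, inner ℝ (b 0) (A a) ≤ inner ℝ (b 0) (A k)) : a - 1 ∉ S ∨ a + 1 ∉ S := by
  by_contra! hcon
  obtain ⟨h1, h2⟩ := hcon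
  obtain ⟨S₁, S₂, ⟨u, c₁, -, rfl, -⟩, -, -, -, hS1, hS2, hdis⟩ :=
    hA.exists_two_faces hn hcol (h.exposed_of_min hn hA ha hmin).1
  have d1 := hA.dist_eq_one hn a
  have d2 := hA.dist_eq_one hn (a - 1)
  rw [sub_add_cancel, h.dist_eq h1 ha, abs_of_nonneg (sub_nonneg.2 (hmin _ h1))] at d2
  rw [dist_comm, h.dist_eq h2 ha, abs_of_nonneg (sub_nonneg.2 (hmin _ h2))] at d1
  -- Two neighbours on the same side at distance `1` coincide, so the supporting line through `a +
  -- 1` also contains `a - 1`, against the disjointness at `a`.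
  have heq : A (a - 1) = A (a + 1) := by
    rw [← sub_eq_zero, h.sub_eq h1 h2,
      show inner ℝ (b 0) (A (a - 1)) - inner ℝ (b 0) (A (a + 1)) = 0 by linarith, zero_smul]
  have hmem : a - 1 ∈ contact A u c₁ := by
    change inner ℝ u (A (a - 1)) = c₁
    rw [heq]
    exact hS1
  have := hdis _ hmem hS2
  have hne := hA.ne_succ hn (a - 1)
  rw [sub_add_cancel] at hne
  exact hne (by rw [this])

theorem LineFrame.end_of_max (h : LineFrame A S b c) (hn : 2 ≤ n) (hA : Taut A)
    (hcol : ¬ Collinear ℝ (range A)) {a : Fin n} (ha : a ∈ S)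
    (hmax : ∀ k ∈ S, inner ℝ (b 0) (A k) ≤ inner ℝ (b 0) (A a)) : a - 1 ∉ S ∨ a + 1 ∉ S := by
  obtain ⟨b', h0, -, h'⟩ := h.exists_neg
  exact h'.end_of_min hn hA hcol ha (fun k hk => by
    rw [h0, inner_neg_left, inner_neg_left]
    exact neg_le_neg (hmax k hk))

/-- Membership is propagated forwards from `a` and non-membership backwards from `a - 1`; stopping
early would produce a second exit besides `e`. -/
theorem IsCyclicInterval.eq_arc (hS : IsCyclicInterval S) {a e : Fin n} (ha : a ∈ S) (he : e ∈ S)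
    (ha' : a - 1 ∉ S) (he' : e + 1 ∉ S) : S = {k | k - a ≤ e - a} := by
  have hin : ∀ m : ℕ, ∀ t : Fin n, t.val = m → t ≤ e - a → t + a ∈ S := by
    intro m
    induction m with
    | zero =>
      intro t ht _
      rw [show t = 0 from Fin.ext ht, zero_add]
      exact ha
    | succ m ih =>
      intro t ht hte
      have hlt : m + 1 < n := ht ▸ t.2
      have e1 : (⟨m, by omega⟩ : Fin n) + 1 = t := by
        ext
        rw [Fin.val_add_one_of_lt' hlt, ht]
      have hmem := ih ⟨m, by omega⟩ rfl (le_trans (by rw [Fin.le_def]; simp [ht]) hte)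
      by_contra hcon
      rw [← e1, add_right_comm] at hcon
      have h2 := hS.exit_unique hmem he hcon he'
      rw [Fin.le_def, ← h2, add_sub_cancel_right, ht] at hte
      simp at hte
  have hout : ∀ m : ℕ, ∀ t : Fin n, t.val + m + 1 = n → e - a < t → t + a ∉ S := by
    intro m
    induction m with
    | zero =>
      intro t ht _ hmem
      rcases Fin.val_add_one_cases t with h | h
      · omega
      · have : t = -1 := eq_neg_of_add_eq_zero_left (Fin.ext h.2)
        rw [this, neg_add_eq_sub] at hmem
        exact ha' hmem
    | succ m ih =>
      intro t ht hlt hmem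
      rcases Fin.val_add_one_cases t with h | h
      · have h1 := ih (t + 1) (by omega) (by rw [Fin.lt_def] at hlt ⊢; omega)
        rw [add_right_comm] at h1
        have h2 := hS.exit_unique hmem he h1 he'
        rw [← h2, add_sub_cancel_right] at hlt
        exact hlt.false
      · omega
  ext k
  constructor
  · intro hk
    by_contra hlt
    exact hout (n - 1 - (k - a).val) (k - a) (by have := (k - a).2; omega) (not_le.1 hlt)
      (by rwa [sub_add_cancel])
  · intro hk
    have := hin _ (k - a) rfl hk
    rwa [sub_add_cancel] at this

/-- The points on a proper supporting line are an arc that runs strictly monotonically. -/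
theorem LineFrame.exists_arc (h : LineFrame A S b c) (hn : 2 ≤ n) (hA : Taut A)
    (hcol : ¬ Collinear ℝ (range A)) (hne : S.Nonempty) :
    ∃ (b' : OrthonormalBasis (Fin 3) ℝ Space3) (a m : Fin n), LineFrame A S b' c ∧ b' 1 = b 1 ∧
      (∀ k, k ∈ S ↔ k - a ≤ m) ∧
      (∀ k ∈ S, inner ℝ (b' 0) (A k) ≤ inner ℝ (b' 0) (A (m + a))) ∧
      ∀ i j, i < j → j ≤ m → inner ℝ (b' 0) (A (i + a)) < inner ℝ (b' 0) (A (j + a)) := by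
  have key : ∀ (b' : OrthonormalBasis (Fin 3) ℝ Space3), LineFrame A S b' c → b' 1 = b 1 →
      ∀ a ∈ S, ∀ e ∈ S, (∀ k ∈ S, inner ℝ (b' 0) (A a) ≤ inner ℝ (b' 0) (A k)) →
      (∀ k ∈ S, inner ℝ (b' 0) (A k) ≤ inner ℝ (b' 0) (A e)) → a - 1 ∉ S → e + 1 ∉ S →
      ∃ (b' : OrthonormalBasis (Fin 3) ℝ Space3) (a m : Fin n), LineFrame A S b' c ∧ b' 1 = b 1 ∧
      (∀ k, k ∈ S ↔ k - a ≤ m) ∧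
      (∀ k ∈ S, inner ℝ (b' 0) (A k) ≤ inner ℝ (b' 0) (A (m + a))) ∧
      ∀ i j, i < j → j ≤ m → inner ℝ (b' 0) (A (i + a)) < inner ℝ (b' 0) (A (j + a)) := by
    intro b' h' hb1 a ha e he hmin hmax ha' he'
    have hS := (h'.isCyclicInterval hA).eq_arc ha he ha' he'
    have hS' : ∀ k, k ∈ S ↔ k - a ≤ e - a := fun k => by
      conv_lhs => rw [hS]
      rfl
    have hmax' : ∀ k ∈ S, inner ℝ (b' 0) (A k) ≤ inner ℝ (b' 0) (A (e - a + a)) := by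
      rwa [sub_add_cancel]
    exact ⟨b', a, e - a, h', hb1, hS', hmax', fun i j hij hj => h'.strictMono hn hA
      (fun t ht => (hS' _).2 (by rwa [add_sub_cancel_right])) hmin hmax' hij hj⟩
  obtain ⟨a, ha, hmin⟩ := S.toFinite.exists_minimalFor (fun k => inner ℝ (b 0) (A k)) S hne |>.imp
    fun a h => (⟨h.1, fun k hk => le_of_not_gt fun hlt => hlt.not_ge (h.2 hk hlt.le)⟩ :
      a ∈ S ∧ ∀ k ∈ S, inner ℝ (b 0) (A a) ≤ inner ℝ (b 0) (A k))
  obtain ⟨e, he, hmax⟩ := S.toFinite.exists_maximalFor (fun k => inner ℝ (b 0) (A k)) S hne |>.imp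
    fun a h => (⟨h.1, fun k hk => le_of_not_gt fun hlt => hlt.not_ge (h.2 hk hlt.le)⟩ :
      a ∈ S ∧ ∀ k ∈ S, inner ℝ (b 0) (A k) ≤ inner ℝ (b 0) (A a))
  have hcyc := h.isCyclicInterval hA
  by_cases hae : a = e
  · subst hae
    have hall : ∀ k ∈ S, k = a := fun k hk => by
      by_contra hka
      exact ((h.exposed_of_min hn hA ha hmin).2 k hk hka).not_ge (hmax k hk)
    refine key b h rfl a ha a he hmin hmax (fun hm => ?_) (fun hm => ?_)
    · have := hA.ne_succ hn (a - 1)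
      rw [sub_add_cancel, hall _ hm] at this
      exact this rfl
    · have := hA.ne_succ hn a
      rw [hall _ hm] at this
      exact this rfl
  -- Minimum and maximum cannot both be entries or both be exits; in the reversed order the
  -- direction of the line is flipped.
  rcases h.end_of_min hn hA hcol ha hmin with h1 | h1 <;>
    rcases h.end_of_max hn hA hcol he hmax with h2 | h2
  · exact absurd (hcyc.entry_unique ha he h1 h2) hae
  · exact key b h rfl a ha e he hmin hmax h1 h2
  · obtain ⟨b', h0, hb1, h'⟩ := h.exists_neg
    refine key b' h' hb1 e he a ha (fun k hk => ?_) (fun k hk => ?_) h2 h1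
    · rw [h0, inner_neg_left, inner_neg_left]
      exact neg_le_neg (hmax k hk)
    · rw [h0, inner_neg_left, inner_neg_left]
      exact neg_le_neg (hmin k hk)
  · exact absurd (hcyc.exit_unique ha he h1 h2) hae

/-- The property passes from each edge to the next: a supporting line of one edge either contains
the next edge too, or ends at the common vertex. That vertex is then exposed, and a second
supporting line contains the next edge. -/
theorem Taut.exists_properFace_edge (hn : 2 ≤ n) (hA : Taut A) (hcol : ¬ Collinear ℝ (range A))
    (i : Fin n) : ∃ S, IsProperFace A S ∧ i ∈ S ∧ i + 1 ∈ S := by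
  obtain ⟨z, hz, hzA⟩ := hA.exists_normal
  have hexp : ∀ i, IsExposedVertex A i → ∃ S, IsProperFace A S ∧ i ∈ S ∧ i + 1 ∈ S := by
    intro i hi
    obtain ⟨S₁, -, hS, -, h1, -, h2, -, -⟩ := hA.exists_two_faces hn hcol hi
    exact ⟨S₁, hS, h1, h2⟩
  obtain ⟨i₀, hi₀⟩ := Finite.exists_max fun i => ‖A i‖
  obtain ⟨hS₀, hv₀⟩ := supports_of_norm_le hi₀
  refine Fin.cyclic_induction (p := fun i => ∃ S, IsProperFace A S ∧ i ∈ S ∧ i + 1 ∈ S) (k := i₀) (hexp _ ⟨_, _, hS₀, ?_⟩) ?_ i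
  · exact eq_singleton_iff_unique_mem.2 ⟨(hv₀ _).2 rfl, fun k hk =>
      hA.contact_subsingleton hn hS₀ (fun j hj => (hv₀ j).1 hj) hk ((hv₀ _).2 rfl)⟩
  · rintro i ⟨S, hS, hi, hi1⟩
    by_cases hi2 : i + 1 + 1 ∈ S
    · exact ⟨S, hS, hi1, hi2⟩
    obtain ⟨b, c, h⟩ := hS.exists_lineFrame ⟨i, hi⟩ hz hzA
    obtain ⟨b', a, m, h', -, hSm, hmax, -⟩ := h.exists_arc hn hA hcol ⟨i, hi⟩
    have hma : m + a ∈ S := (hSm _).2 (by rw [add_sub_cancel_right])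
    refine hexp _ ?_
    have : i + 1 = m + a := by
      rw [hSm] at hi1 hi2
      rw [← sub_eq_iff_eq_add]
      rw [add_sub_right_comm, not_le, Fin.lt_def] at hi2
      rw [Fin.le_def] at hi1
      rw [Fin.ext_iff]
      have := m.2
      rcases Fin.val_add_one_cases (i + 1 - a) with h | h <;> omega
    rw [this]
    exact (h'.exposed_of_max hn hA hma hmax).1

end Faces

/-! ### Supporting planes and the relative boundary of the hull -/

section Boundary

variable {n : ℕ} [NeZero n] {A : Fin n → Space3} {u : Space3} {c : ℝ}

omit [NeZero n] in
theorem Supports.le_of_mem_convexHull (hS : Supports A u c) {x : Space3}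
    (hx : x ∈ convexHull ℝ (range A)) : inner ℝ u x ≤ c := by
  have hconv : Convex ℝ {y : Space3 | inner ℝ u y ≤ c} :=
    convex_halfSpace_le (innerSL ℝ u).toLinearMap.isLinear c
  exact convexHull_min (by rintro _ ⟨i, rfl⟩; exact hS i) hconv hx

-- From a relative interior point one could move a little away from `A j` inside the hull, which
-- would cross the supporting plane.
omit [NeZero n] in
theorem mem_intrinsicFrontier_of_supports (hS : Supports A u c) {x : Space3}
    (hx : x ∈ convexHull ℝ (range A)) (hxc : inner ℝ u x = c) {j : Fin n}
    (hj : j ∉ contact A u c) : x ∈ intrinsicFrontier ℝ (convexHull ℝ (range A)) := by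
  rw [← intrinsicClosure_sdiff_intrinsicInterior]
  refine ⟨subset_intrinsicClosure (𝕜 := ℝ) hx, fun hint => ?_⟩
  obtain ⟨y, hy, rfl⟩ := mem_intrinsicInterior.1 hint
  have hjK : A j ∈ convexHull ℝ (range A) := subset_convexHull ℝ _ (mem_range_self j)
  set g : ℝ → affineSpan ℝ (convexHull ℝ (range A)) := fun ε =>
    ⟨AffineMap.lineMap (y : Space3) (A j) (-ε),
      AffineMap.lineMap_mem _ y.2 (subset_affineSpan ℝ _ hjK)⟩ with hg
  have hgc : Continuous g :=
    (AffineMap.lineMap_continuous.comp continuous_neg).subtype_mk _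
  have hg0 : g 0 = y := Subtype.ext (by simp [hg])
  have hev : ∀ᶠ ε in nhdsWithin (0 : ℝ) (Ioi 0),
      g ε ∈ ((↑) ⁻¹' convexHull ℝ (range A) : Set (affineSpan ℝ (convexHull ℝ (range A)))) := by
    refine nhdsWithin_le_nhds (hgc.continuousAt.eventually_mem ?_)
    rw [hg0]
    exact mem_interior_iff_mem_nhds.1 hy
  obtain ⟨ε, hε, hε0⟩ := (hev.and self_mem_nhdsWithin).exists
  have hε0' : 0 < ε := hε0
  have h1 := hS.le_of_mem_convexHull hε
  have h2 : inner ℝ u (A j) < c := lt_of_le_of_ne (hS j) hj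
  simp only [hg, AffineMap.lineMap_apply_module'] at h1
  rw [inner_add_right, inner_smul_right, inner_sub_right, hxc] at h1
  nlinarith

/-- Hahn–Banach applied in the direction space `V` of the affine span, where the translated hull `C`
has interior points. -/
theorem exists_supports_of_mem_intrinsicFrontier {x : Space3}
    (hx : x ∈ intrinsicFrontier ℝ (convexHull ℝ (range A))) :
    x ∈ convexHull ℝ (range A) ∧
      ∃ u c, Supports A u c ∧ inner ℝ u x = c ∧ ∃ j, j ∉ contact A u c := by
  set K := convexHull ℝ (range A) with hK
  have hKconv : Convex ℝ K := convex_convexHull ℝ _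
  have hxK : x ∈ K :=
    intrinsicFrontier_subset ((finite_range A).isClosed_convexHull ℝ) hx
  refine ⟨hxK, ?_⟩
  have hxint : x ∉ intrinsicInterior ℝ K := by
    rw [← intrinsicClosure_sdiff_intrinsicInterior] at hx
    exact hx.2
  set p := A 0 with hp
  have hpK : p ∈ K := subset_convexHull ℝ _ (mem_range_self 0)
  have hps : p ∈ affineSpan ℝ K := subset_affineSpan ℝ _ hpK
  set V := (affineSpan ℝ K).direction with hV
  have hvs : ∀ {y}, y ∈ affineSpan ℝ K → y - p ∈ V := fun hy =>
    AffineSubspace.vsub_mem_direction hy hps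
  have hva : ∀ d : V, (d : Space3) + p ∈ affineSpan ℝ K := fun d =>
    AffineSubspace.vadd_mem_of_mem_direction d.2 hps
  set C : Set V := {d | (d : Space3) + p ∈ K} with hC
  have hCconv : Convex ℝ C := by
    intro d hd e he s t hs ht hst
    have := hKconv hd he hs ht hst
    change ((s • d + t • e : V) : Space3) + p ∈ K
    convert this using 1
    rw [smul_add, smul_add]
    have h1 : p = s • p + t • p := by rw [← add_smul, hst, one_smul]
    push_cast
    nth_rw 1 [h1]
    abel
  have hCint : (interior C).Nonempty := by
    obtain ⟨_, ⟨y, hy, rfl⟩⟩ := Set.Nonempty.intrinsicInterior hKconv ⟨p, hpK⟩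
    set φ : V → affineSpan ℝ K := fun d => ⟨(d : Space3) + p, hva d⟩ with hφ
    have hφc : Continuous φ := (continuous_subtype_val.add continuous_const).subtype_mk _
    refine ⟨⟨y - p, hvs y.2⟩, mem_interior.2 ⟨φ ⁻¹' interior ((↑) ⁻¹' K), fun d hd => ?_,
      isOpen_interior.preimage hφc, ?_⟩⟩
    · have h1 : φ d ∈ ((↑) ⁻¹' K : Set (affineSpan ℝ K)) := interior_subset (mem_preimage.1 hd)
      exact h1
    · have : φ ⟨y - p, hvs y.2⟩ = y := Subtype.ext (by simp [hφ])
      rw [mem_preimage, this]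
      exact hy
  set x₀ : V := ⟨x - p, hvs (subset_affineSpan ℝ _ hxK)⟩ with hx₀
  have hx₀int : x₀ ∉ interior C := by
    intro h
    set ψ : affineSpan ℝ K → V := fun y => ⟨(y : Space3) - p, hvs y.2⟩ with hψ
    have hψc : Continuous ψ := (continuous_subtype_val.sub continuous_const).subtype_mk _
    refine hxint (mem_intrinsicInterior.2 ⟨⟨x, subset_affineSpan ℝ _ hxK⟩, mem_interior.2
      ⟨ψ ⁻¹' interior C, fun y hy => ?_, isOpen_interior.preimage hψc, h⟩, rfl⟩)
    have h1 : ψ y ∈ C := interior_subset (mem_preimage.1 hy)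
    simpa [hψ, hC] using h1
  obtain ⟨f, hf⟩ := geometric_hahn_banach_open_point hCconv.interior isOpen_interior hx₀int
  have hfle : ∀ d ∈ C, f d ≤ f x₀ := by
    have h1 : closure (interior C) ⊆ {d | f d ≤ f x₀} :=
      closure_minimal (fun d hd => (hf d hd).le) (isClosed_le f.continuous continuous_const)
    rw [hCconv.closure_interior_eq_closure_of_nonempty_interior hCint] at h1
    exact fun d hd => h1 (subset_closure hd)
  obtain ⟨g, hg, -⟩ := exists_extension_norm_eq V f
  set u : Space3 := (InnerProductSpace.toDual ℝ Space3).symm g with hu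
  have hgu : ∀ x, inner ℝ u x = g x := fun x => InnerProductSpace.toDual_symm_apply
  have hgf : ∀ {y} (hy : y ∈ affineSpan ℝ K), g y = f ⟨y - p, hvs hy⟩ + g p := fun {y} hy => by
    rw [← hg, ← map_add]
    simp
  have hsub : ∀ i, A i ∈ K := fun i => subset_convexHull ℝ _ (mem_range_self i)
  refine ⟨u, inner ℝ u x, fun i => ?_, rfl, ?_⟩
  · rw [hgu, hgu, hgf (subset_affineSpan ℝ _ (hsub i)), hgf (subset_affineSpan ℝ _ hxK)]
    refine add_le_add_left (hfle _ ?_) _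
    simpa [hC] using hsub i
  -- The functional is not constant on the hull, since it is strictly smaller at an interior point
  -- of `C`.
  · by_contra! hall
    obtain ⟨d, hd⟩ := hCint
    have h0 : d ∈ C := interior_subset hd
    have h1 : (d : Space3) + p ∈ K := h0
    have h2 : Supports A (-u) (-inner ℝ u x) := fun i => by
      rw [inner_neg_left]
      exact (neg_inj.2 (hall i)).le
    have h3 := h2.le_of_mem_convexHull h1
    rw [inner_neg_left, neg_le_neg_iff, hgu, hgu, hgf (subset_affineSpan ℝ _ hxK), map_add,
      hg d] at h3
    exact absurd (hf d hd) (not_lt.2 (le_of_add_le_add_right h3))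

-- In a convex combination attaining the maximum `c`, points below the plane have weight zero.
omit [NeZero n] in
theorem Supports.mem_convexHull_contact (hS : Supports A u c) {x : Space3}
    (hx : x ∈ convexHull ℝ (range A)) (hxc : inner ℝ u x = c) :
    x ∈ convexHull ℝ (A '' contact A u c) := by
  obtain ⟨ι, _, w, z, hw0, hw1, hz, rfl⟩ := mem_convexHull_iff_exists_fintype.1 hx
  have hzle : ∀ i, inner ℝ u (z i) ≤ c := fun i => by
    obtain ⟨j, hj⟩ := hz i
    rw [← hj]
    exact hS j
  have hsum : ∑ i, w i * (c - inner ℝ u (z i)) = 0 := by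
    simp only [mul_sub, Finset.sum_sub_distrib, ← Finset.sum_mul, hw1, one_mul]
    rw [inner_sum] at hxc
    simp only [inner_smul_right] at hxc
    rw [hxc, sub_self]
  have hterm : ∀ i, w i * (c - inner ℝ u (z i)) = 0 := fun i =>
    (Finset.sum_eq_zero_iff_of_nonneg fun i _ =>
      mul_nonneg (hw0 i) (sub_nonneg.2 (hzle i))).1 hsum i (Finset.mem_univ i)
  have hmem : ∀ i, w i ≠ 0 → z i ∈ A '' contact A u c := fun i hi => by
    obtain ⟨j, hj⟩ := hz i
    refine ⟨j, ?_, hj⟩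
    have := (mul_eq_zero.1 (hterm i)).resolve_left hi
    rw [← hj] at this
    exact (sub_eq_zero.1 this).symm
  obtain ⟨i₀, hi₀⟩ : ∃ i, w i ≠ 0 := by
    by_contra! h
    simp [h] at hw1
  classical
  refine mem_convexHull_of_exists_fintype w (fun i => if w i = 0 then z i₀ else z i) hw0 hw1
    (fun i => ?_) (Finset.sum_congr rfl fun i _ => ?_)
  · split_ifs with h
    · exact hmem _ hi₀
    · exact hmem _ h
  · split_ifs with h
    · simp [h]
    · rfl

omit [NeZero n] in
theorem Supports.mem_contact_of_openSegment (hS : Supports A u c) {j k : Fin n} {x : Space3}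
    (hx : x ∈ openSegment ℝ (A j) (A k)) (hxc : inner ℝ u x = c) :
    j ∈ contact A u c ∧ k ∈ contact A u c := by
  obtain ⟨s, t, hs, ht, hst, rfl⟩ := hx
  rw [inner_add_right, inner_smul_right, inner_smul_right] at hxc
  have h1 := hS j
  have h2 := hS k
  constructor
  · refine le_antisymm h1 (le_of_not_gt fun hlt => ?_)
    have e1 := mul_lt_mul_of_pos_left hlt hs
    have e2 := mul_le_mul_of_nonneg_left h2 ht.le
    have e3 : s * c + t * c = c := by rw [← add_mul, hst, one_mul]
    linarith
  · refine le_antisymm h2 (le_of_not_gt fun hlt => ?_)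
    have e1 := mul_lt_mul_of_pos_left hlt ht
    have e2 := mul_le_mul_of_nonneg_left h1 hs.le
    have e3 : s * c + t * c = c := by rw [← add_mul, hst, one_mul]
    linarith

end Boundary

/-! ### Taut polygons are convex -/

section Polygon

variable {n : ℕ} [NeZero n] {A : Fin n → Space3}

omit [NeZero n] in
theorem coplanar_of_normal {z : Space3} (hz : ‖z‖ = 1)
    (hzA : ∀ i j, inner ℝ z (A i - A j) = 0) : Coplanar ℝ (range A) := by
  rw [coplanar_iff_finrank_le_two]
  have hle : vectorSpan ℝ (range A) ≤ (Submodule.span ℝ {z})ᗮ := by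
    rw [vectorSpan_def, Submodule.span_le]
    rintro _ ⟨_, ⟨i, rfl⟩, _, ⟨j, rfl⟩, rfl⟩
    exact Submodule.mem_orthogonal_singleton_iff_inner_right.2 (hzA i j)
  have hfin : Fact (Module.finrank ℝ Space3 = 2 + 1) := ⟨by simp⟩
  have h2 := Submodule.finrank_orthogonal_span_singleton (𝕜 := ℝ) (n := 2) (v := z)
    (fun h => by rw [h, norm_zero] at hz; exact zero_ne_one hz)
  exact (Submodule.finrank_mono hle).trans h2.le

/-- A proper supporting line of a noncollinear taut polygon meets it in an arc. -/
theorem IsProperFace.exists_arc {S : Set (Fin n)} (hS : IsProperFace A S) (hn : 2 ≤ n)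
    (hA : Taut A) (hcol : ¬ Collinear ℝ (range A)) (hne : S.Nonempty) :
    ∃ (b : OrthonormalBasis (Fin 3) ℝ Space3) (c : ℝ) (a m : Fin n), LineFrame A S b c ∧
      (∀ k, k ∈ S ↔ k - a ≤ m) ∧ m.val + 1 < n ∧
      (∀ k ∈ S, inner ℝ (b 0) (A k) ≤ inner ℝ (b 0) (A (m + a))) ∧
      ∀ i j, i < j → j ≤ m → inner ℝ (b 0) (A (i + a)) < inner ℝ (b 0) (A (j + a)) := by
  obtain ⟨z, hz, hzA⟩ := hA.exists_normal
  obtain ⟨b, c, h⟩ := hS.exists_lineFrame hne hz hzA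
  obtain ⟨b', a, m, h', -, hSm, hmax, hmono⟩ := h.exists_arc hn hA hcol hne
  refine ⟨b', c, a, m, h', hSm, ?_, hmax, hmono⟩
  by_contra hm
  obtain ⟨u, c, -, -, huniv⟩ := hS
  refine huniv (eq_univ_of_forall fun k => (hSm k).2 ?_)
  rw [Fin.le_def]
  have := (k - a).2
  omega

theorem Taut.isNondegenerateConvexPolygon (hn : 2 ≤ n) (hA : Taut A)
    (hcol : ¬ Collinear ℝ (range A)) : IsNondegenerateConvexPolygon A := by
  obtain ⟨z, hz, hzA⟩ := hA.exists_normal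
  refine ⟨coplanar_of_normal hz hzA, hcol, ?_, ?_, Subset.antisymm ?_ ?_⟩
  · intro i j hij
    obtain ⟨S, hS, hi, -⟩ := hA.exists_properFace_edge hn hcol i
    obtain ⟨b, c, a, m, h, hSm, -, -, hmono⟩ := hS.exists_arc hn hA hcol ⟨i, hi⟩
    have hj : j ∈ S := by
      rw [← h.contact_eq] at hi ⊢
      change inner ℝ (b 1) (A j) = c
      rw [← hij]
      exact hi
    rw [hSm] at hi hj
    rcases lt_trichotomy (i - a) (j - a) with hlt | heq | hlt
    · have := hmono _ _ hlt hj
      rw [sub_add_cancel, sub_add_cancel, hij] at this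
      exact absurd this (lt_irrefl _)
    · exact sub_left_injective heq
    · have := hmono _ _ hlt hi
      rw [sub_add_cancel, sub_add_cancel, hij] at this
      exact absurd this (lt_irrefl _)
  · intro i j hij
    rw [disjoint_left]
    intro x hxi hxj
    obtain ⟨S, hS, hi, hi1⟩ := hA.exists_properFace_edge hn hcol i
    obtain ⟨b, c, a, m, h, hSm, hmn, -, hmono⟩ := hS.exists_arc hn hA hcol ⟨i, hi⟩
    have hxc : inner ℝ (b 1) x = c := by
      obtain ⟨s, t, hs, ht, hst, rfl⟩ := hxi
      rw [← h.contact_eq] at hi hi1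
      rw [inner_add_right, inner_smul_right, inner_smul_right, show inner ℝ (b 1) (A i) = c from hi,
        show inner ℝ (b 1) (A (i + 1)) = c from hi1, ← add_mul, hst, one_mul]
    obtain ⟨hj, hj1⟩ := h.supports.mem_contact_of_openSegment hxj hxc
    rw [h.contact_eq] at hj hj1
    -- Overlapping edges lie on one supporting line. There each edge occupies the coordinate
    -- interval of one step of a strictly monotone arc, so different edges are disjoint.
    have key : ∀ k, k ∈ S → k + 1 ∈ S → x ∈ openSegment ℝ (A k) (A (k + 1)) →
        (k - a).val + 1 = (k + 1 - a).val ∧ k + 1 - a ≤ m ∧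
        inner ℝ (b 0) (A k) < inner ℝ (b 0) x ∧ inner ℝ (b 0) x < inner ℝ (b 0) (A (k + 1)) := by
      intro k hk hk1 hx
      rw [hSm] at hk hk1
      have hval : (k - a).val + 1 = (k + 1 - a).val := by
        rw [add_sub_right_comm]
        rw [Fin.le_def] at hk
        rcases Fin.val_add_one_cases (k - a) with h | h <;> omega
      have hlt := hmono (k - a) (k + 1 - a) (by rw [Fin.lt_def]; omega) hk1
      rw [sub_add_cancel, sub_add_cancel] at hlt
      obtain ⟨s, t, hs, ht, hst, rfl⟩ := hx
      rw [inner_add_right, inner_smul_right, inner_smul_right]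
      obtain rfl : s = 1 - t := by linarith
      have e1 := mul_pos ht (sub_pos.2 hlt)
      have e2 := mul_pos hs (sub_pos.2 hlt)
      refine ⟨hval, hk1, ?_, ?_⟩ <;> linarith
    obtain ⟨vi, mi, li, ui⟩ := key i hi hi1 hxi
    obtain ⟨vj, mj, lj, uj⟩ := key j hj hj1 hxj
    have hle : ∀ p q : Fin n, p ≤ q → q ≤ m →
        inner ℝ (b 0) (A (p + a)) ≤ inner ℝ (b 0) (A (q + a)) := fun p q hpq hq => by
      rcases hpq.eq_or_lt with rfl | hlt
      · exact le_rfl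
      · exact (hmono p q hlt hq).le
    rcases lt_trichotomy (i - a) (j - a) with hlt | heq | hlt
    · have := hle (i + 1 - a) (j - a) (by rw [Fin.lt_def] at hlt; rw [Fin.le_def]; omega)
        ((hSm j).1 hj)
      rw [sub_add_cancel, sub_add_cancel] at this
      linarith
    · exact hij (sub_left_injective heq)
    · have := hle (j + 1 - a) (i - a) (by rw [Fin.lt_def] at hlt; rw [Fin.le_def]; omega)
        ((hSm i).1 hi)
      rw [sub_add_cancel, sub_add_cancel] at this
      linarith
  · refine iUnion_subset fun i x hx => ?_
    obtain ⟨S, ⟨u, c, hsup, rfl, huniv⟩, hi, hi1⟩ := hA.exists_properFace_edge hn hcol i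
    obtain ⟨j, hj⟩ := (ne_univ_iff_exists_notMem _).1 huniv
    refine mem_intrinsicFrontier_of_supports hsup ?_ ?_ hj
    · exact segment_subset_convexHull (mem_range_self i) (mem_range_self (i + 1)) hx
    · obtain ⟨s, t, hs, ht, hst, rfl⟩ := hx
      rw [inner_add_right, inner_smul_right, inner_smul_right, show inner ℝ u (A i) = c from hi,
        show inner ℝ u (A (i + 1)) = c from hi1, ← add_mul, hst, one_mul]
  · intro x hx
    obtain ⟨hxK, u, c, hsup, hxc, j, hj⟩ := exists_supports_of_mem_intrinsicFrontier hx
    have hxS := hsup.mem_convexHull_contact hxK hxc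
    have hne : (contact A u c).Nonempty := by
      rw [← image_nonempty (f := A), ← convexHull_nonempty_iff (𝕜 := ℝ)]
      exact ⟨x, hxS⟩
    have hS : IsProperFace A (contact A u c) :=
      ⟨u, c, hsup, rfl, fun h => hj (h ▸ mem_univ j)⟩
    obtain ⟨b, c', a, m, h, hSm, hmn, hmax, hmono⟩ := hS.exists_arc hn hA hcol hne
    have haS : a ∈ contact A u c := (hSm a).2 (by rw [sub_self]; exact Fin.zero_le _)
    have hmin : ∀ k ∈ contact A u c, inner ℝ (b 0) (A a) ≤ inner ℝ (b 0) (A k) := by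
      intro k hk
      have hk' := (hSm k).1 hk
      rcases (Fin.zero_le (k - a)).eq_or_lt with h0 | h0
      · rw [sub_eq_zero.1 h0.symm]
      · have := hmono _ _ h0 hk'
        rw [zero_add, sub_add_cancel] at this
        exact this.le
    obtain ⟨r, hr0, hr1, hxr⟩ : ∃ r : ℝ, inner ℝ (b 0) (A a) ≤ r ∧
        r ≤ inner ℝ (b 0) (A (m + a)) ∧ x = A a + (r - inner ℝ (b 0) (A a)) • b 0 := by
      have hconv : Convex ℝ ((fun r : ℝ => A a + (r - inner ℝ (b 0) (A a)) • b 0) ''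
          Icc (inner ℝ (b 0) (A a)) (inner ℝ (b 0) (A (m + a)))) := by
        have : (fun r : ℝ => A a + (r - inner ℝ (b 0) (A a)) • b 0) =
            fun r : ℝ => AffineMap.lineMap (A a - inner ℝ (b 0) (A a) • b 0)
              (A a - inner ℝ (b 0) (A a) • b 0 + b 0) r := by
          funext r
          rw [AffineMap.lineMap_apply_module']
          module
        rw [this]
        exact (convex_Icc _ _).affine_image _
      obtain ⟨r, ⟨h0, h1⟩, rfl⟩ := convexHull_min (by
        rintro _ ⟨k, hk, rfl⟩
        exact ⟨inner ℝ (b 0) (A k), ⟨hmin k hk, hmax k hk⟩, by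
          simp only [← h.sub_eq hk haS, add_sub_cancel]⟩) hconv hxS
      exact ⟨r, h0, h1, rfl⟩
    -- Descending along the arc from its top, the step whose coordinate interval contains `r` is
    -- found.
    have key : ∀ t : ℕ, ∀ k : Fin n, k.val = t → k ≤ m → r ≤ inner ℝ (b 0) (A (k + a)) →
        x ∈ ⋃ i : Fin n, segment ℝ (A i) (A (i + 1)) := by
      intro t
      induction t with
      | zero =>
        intro k hk _ hle
        rw [show k = 0 from Fin.ext hk, zero_add] at hle
        rw [hxr, le_antisymm hle hr0, sub_self, zero_smul, add_zero]
        exact mem_iUnion.2 ⟨a, left_mem_segment ℝ _ _⟩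
      | succ t ih =>
        intro k hk hkm hle
        have hlt : t + 1 < n := hk ▸ k.2
        set k' : Fin n := ⟨t, by omega⟩ with hk'
        have hkk : k' + 1 = k := by
          ext
          rw [Fin.val_add_one_of_lt' hlt, hk]
        have hk'm : k' ≤ m := le_trans (by rw [Fin.le_def]; simp [hk', hk]) hkm
        rcases le_total r (inner ℝ (b 0) (A (k' + a))) with hr | hr
        · exact ih k' rfl hk'm hr
        · have m1 : k' + a ∈ contact A u c := (hSm _).2 (by rwa [add_sub_cancel_right])
          have m2 : k + a ∈ contact A u c := (hSm _).2 (by rwa [add_sub_cancel_right])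
          have hstep := hmono k' k (by rw [Fin.lt_def]; simp [hk', hk]) hkm
          have hd := hA.dist_eq_one hn (k' + a)
          rw [add_right_comm, hkk, dist_comm, h.dist_eq m2 m1,
            abs_of_pos (sub_pos.2 hstep)] at hd
          refine mem_iUnion.2 ⟨k' + a, ?_⟩
          rw [add_right_comm, hkk, segment_eq_image']
          -- The coordinate difference is itself the segment parameter, as the edge has length `1`.
          refine ⟨r - inner ℝ (b 0) (A (k' + a)), ⟨by linarith, by linarith⟩, ?_⟩
          simp only [h.sub_eq m2 m1, hd, one_smul]
          have := h.sub_eq m1 haS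
          rw [hxr, add_comm (A a), ← sub_eq_iff_eq_add, add_sub_right_comm, this, ← add_smul]
          congr 1
          ring
    exact key m.val m rfl le_rfl hr1

/-- The line of the points is a supporting line touching all of them, so monotonicity applies to the
arc from the lowest index `a` to the highest `t` and, reversed, to the arc back. -/
theorem Taut.isDegenerateConvexPolygon (hn : 2 ≤ n) (hA : Taut A)
    (hcol : Collinear ℝ (range A)) : IsDegenerateConvexPolygon A := by
  obtain ⟨e₀, he₀⟩ := (collinear_iff_of_mem (p₀ := A 0) (mem_range_self 0)).1 hcol
  choose ρ hρ using fun i => he₀ (A i) (mem_range_self i)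
  have he₀0 : e₀ ≠ 0 := fun h => by
    refine hA.ne_succ hn 0 ?_
    rw [hρ (0 + 1), h]
    simp
  set e : Space3 := ‖e₀‖⁻¹ • e₀ with he
  have he1 : ‖e‖ = 1 := by
    rw [he, norm_smul, norm_inv, norm_norm, inv_mul_cancel₀ (norm_ne_zero_iff.2 he₀0)]
  have hAe : ∀ i, A i = A 0 + (ρ i * ‖e₀‖) • e := fun i => by
    rw [he, smul_smul, mul_assoc, mul_inv_cancel₀ (norm_ne_zero_iff.2 he₀0), mul_one, add_comm]
    exact hρ i
  obtain ⟨z, hz, hez, -⟩ := exists_unit_orthogonal e e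
  obtain ⟨u, hu, heu, hzu⟩ := exists_unit_orthogonal e z
  obtain ⟨b, hb0, hb1, hb2⟩ := exists_orthonormalBasis_eq he1 hu hz heu hez
    (by rw [real_inner_comm]; exact hzu)
  have hperp : ∀ w : Space3, inner ℝ e w = 0 → ∀ i, inner ℝ w (A i) = inner ℝ w (A 0) :=
    fun w hw i => by
      rw [hAe i, inner_add_right, inner_smul_right, real_inner_comm e, hw, mul_zero, add_zero]
  have h : LineFrame A univ b (inner ℝ u (A 0)) := by
    refine ⟨fun i j => ?_, fun i => ?_, eq_univ_of_forall fun i => ?_⟩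
    · rw [hb2, inner_sub_right, hperp z hez i, hperp z hez j, sub_self]
    · rw [hb1, hperp u heu i]
    · rw [hb1]
      exact hperp u heu i
  obtain ⟨a, ha⟩ := Finite.exists_min fun i => inner ℝ (b 0) (A i)
  obtain ⟨t, ht⟩ := Finite.exists_max fun i => inner ℝ (b 0) (A i)
  have hat : a ≠ t := by
    rintro rfl
    have h2 := h.sub_eq (mem_univ a) (mem_univ (a + 1))
    rw [le_antisymm (ha (a + 1)) (ht (a + 1)), sub_self, zero_smul, sub_eq_zero] at h2
    exact hA.ne_succ hn a h2
  obtain ⟨b', hb'0, -, h'⟩ := h.exists_neg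
  have up : ∀ i j, i < j → j ≤ t - a →
      inner ℝ (b 0) (A (i + a)) < inner ℝ (b 0) (A (j + a)) := fun i j hij hj =>
    h.strictMono hn hA (fun _ _ => mem_univ _) (fun k _ => ha k)
      (fun k _ => by rw [sub_add_cancel]; exact ht k) hij hj
  have down : ∀ i j, i < j → j ≤ a - t →
      inner ℝ (b 0) (A (j + t)) < inner ℝ (b 0) (A (i + t)) := fun i j hij hj => by
    have := h'.strictMono hn hA (a := t) (m := a - t) (fun _ _ => mem_univ _)
      (fun k _ => by rw [hb'0, inner_neg_left, inner_neg_left]; exact neg_le_neg (ht k))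
      (fun k _ => by
        rw [sub_add_cancel, hb'0, inner_neg_left, inner_neg_left]; exact neg_le_neg (ha k)) hij hj
    rw [hb'0, inner_neg_left, inner_neg_left] at this
    exact neg_lt_neg_iff.1 this
  have hofNat : ∀ j, (Fin.ofNat n j).val = j % n := fun j => rfl
  have hMn := (t - a).2
  have hM0 : (t - a).val ≠ 0 := fun h0 => hat (sub_eq_zero.1 (Fin.ext h0 : t - a = 0)).symm
  have hat' : (a - t).val = n - (t - a).val := by
    rw [← neg_sub, Fin.val_neg]
    rw [if_neg fun h0 => hM0 (by rw [h0]; rfl)]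
  -- At `j = n` the index wraps to `a`, the end of the descent.
  refine ⟨a, (t - a).val, e, fun j => inner ℝ (b 0) (A (a + Fin.ofNat n j)) - inner ℝ (b 0) (A a),
    hMn.le, he1, fun j _ => ?_, ?_, ?_⟩
  · rw [← hb0, ← h.sub_eq (mem_univ _) (mem_univ _), add_sub_cancel]
  · intro i hi j hj hij
    refine sub_le_sub_right ?_ _
    rcases hij.eq_or_lt with rfl | hlt
    · exact le_rfl
    have hi' : i % n = i := Nat.mod_eq_of_lt (lt_of_le_of_lt hi.2 hMn)
    have hj' : j % n = j := Nat.mod_eq_of_lt (lt_of_le_of_lt hj.2 hMn)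
    rw [add_comm a, add_comm a]
    refine (up _ _ ?_ ?_).le
    · rw [Fin.lt_def, hofNat, hofNat, hi', hj']; exact hlt
    · rw [Fin.le_def, hofNat, hj']; exact hj.2
  · intro i hi j hj hij
    refine sub_le_sub_right ?_ _
    rcases hij.eq_or_lt with rfl | hlt
    · exact le_rfl
    have hsplit : ∀ k, (t - a).val ≤ k → a + Fin.ofNat n k = Fin.ofNat n (k - (t - a).val) + t := by
      intro k hk
      have h1 : Fin.ofNat n k = Fin.ofNat n (k - (t - a).val) + (t - a) := by
        ext
        rw [Fin.val_add, hofNat, hofNat, Nat.mod_add_mod, Nat.sub_add_cancel hk]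
      rw [h1]
      abel
    have hi' : (i - (t - a).val) % n = i - (t - a).val := Nat.mod_eq_of_lt (by
      have := hi.2; omega)
    have hj' : (j - (t - a).val) % n = j - (t - a).val := Nat.mod_eq_of_lt (by
      have := hj.2; omega)
    rw [hsplit i hi.1, hsplit j hj.1]
    refine (down _ _ ?_ ?_).le
    · rw [Fin.lt_def, hofNat, hofNat, hi', hj']
      have := hi.1
      omega
    · rw [Fin.le_def, hofNat, hj', hat']
      have := hj.2
      omega

theorem Taut.isConvexPolygon (hn : 2 ≤ n) (hA : Taut A) : IsConvexPolygon A := by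
  by_cases hcol : Collinear ℝ (range A)
  · exact Or.inr (hA.isDegenerateConvexPolygon hn hcol)
  · exact Or.inl (hA.isNondegenerateConvexPolygon hn hcol)

end Polygon

theorem theorem3p1 (n : ℕ) [NeZero n] (hn : 2 ≤ n) (f : ℝ → ℝ)
    (hf_mono : StrictMonoOn f (Set.Ioi 0)) (hf_cont : ContinuousOn f (Set.Ioi 0))
    (G : InextensibleClosedCurve n)
    (hG : ∀ G' : InextensibleClosedCurve n, G'.energy f ≤ G.energy f) :
    IsConvexPolygon G.particle ∧
    (∀ i : Fin n, dist (G.particle i) (G.particle (i + 1)) = 1) ∧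
    (∀ i : Fin n, ∀ t ∈ Set.Icc (0 : ℝ) 1,
      G.toFun (((i : ℕ) : ℝ) + t) =
        AffineMap.lineMap (G.particle i) (G.particle (i + 1)) t) := by
  have hA := taut_particle_of_energy_le hf_mono hG
  refine ⟨hA.isConvexPolygon hn, hA.dist_eq_one hn, fun i t ht => ?_⟩
  obtain ⟨h1, h2⟩ := G.dist_particle_le i ht
  have h3 := hA.dist_eq_one hn i
  have h4 := dist_triangle (G.particle i) (G.toFun ((i : ℕ) + t)) (G.particle (i + 1))
  -- The distances to the two particles are at most `t` and `1 - t` and sum to at least `1`, so both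
  -- bounds are attained; strict convexity then puts the point on the segment.
  refine eq_lineMap_of_dist_eq_mul_of_dist_eq_mul ?_ ?_ <;> rw [h3] <;> linarith
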